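/- **Setting.** Let $P_X, Q_X$ be probability distributions on a measurable space $\mathcal X$ and let $P_{Y\mid X}$ be a conditional law of a real outcome $Y$ given $X$, with conditional quantiles $q_\beta(x)=\inf\{z: P(Y\le z\mid X=x)\ge\beta\}$. Let $\alpha,\alpha_{\mathrm{lo}},\alpha_{\mathrm{hi}}\in(0,1)$. The training fold $\mathcal Z_{\mathrm{tr}}$ (of size $N$) and the calibration fold $\mathcal Z_{\mathrm{ca}}=(X_i,Y_i)_{i=1}^n$ are independent i.i.d. samples from $P_X\times P_{Y\mid X}$. From $\mathcal Z_{\mathrm{tr}}$ one fits estimates $\hat q_{\alpha_{\mathrm{lo}},N}(x),\hat q_{\alpha_{\mathrm{hi}},N}(x)\in\mathbb R$ of $q_{\alpha_{\mathrm{lo}}}(x),q_{\alpha_{\mathrm{hi}}}(x)$ and an estimate $\hat w_N(x)\in[0,\infty]$ of $w=dQ_X/dP_X$ (all jointly measurable in $(\mathcal Z_{\mathrm{tr}},x)$) with $0<\mathbb E[\hat w_N(X)\mid\mathcal Z_{\mathrm{tr}}]<\infty$ almost surely, where $X\sim P_X$ is independent of $\mathcal Z_{\mathrm{tr}}$; replace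 $\hat w_N$ by $\hat w_N/\mathbb E[\hat w_N(X)\mid\mathcal Z_{\mathrm{tr}}]$, so that $\mathbb E[\hat w_N(X)\mid\mathcal Z_{\mathrm{tr}}]=1$. Below, $\mathbb E$ without conditioning is over $\mathcal Z_{\mathrm{tr}}$ and an independent $X\sim P_X$. *Weighted split-CQR.* Put $V_i=\max\{\hat q_{\alpha_{\mathrm{lo}},N}(X_i)-Y_i,\ Y_i-\hat q_{\alpha_{\mathrm{hi}},N}(X_i)\}$, $W_i=\hat w_N(X_i)$, $\hat p_i(x)=W_i/(\sum_jW_j+\hat w_N(x))$, $\hat p_\infty(x)=\hat w_N(x)/(\sum_jW_j+\hat w_N(x))$ (with $\hat p_i(x)=0$, $\hat p_\infty(x)=1$ if $\hat w_N(x)=\infty$), and let $\eta(x)$ be the $(1-\alpha)$-quantile of $\sum_i\hat p_i(x)\delta_{V_i}+\hat p_\infty(x)\delta_\infty$ (with $\eta(x)=\infty$ if all the weights vanish). The output is $\hat C_{N,n}(x)=[\hat q_{\alpha_{\mathrm{lo}},N}(x)-\eta(x),\ \hat q_{\alpha_{\mathrm{hi}},N}(x)+\eta(x)]$ (all of $\mathbb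 R$ if $\eta(x)=\infty$). **Theorem.** Let $r,b_1,b_2,\delta,M,k,\ell>0$ and $H_N(x)=\max\{|\hat q_{\alpha_{\mathrm{lo}},N}(x)-q_{\alpha_{\mathrm{lo}}}(x)|,\ |\hat q_{\alpha_{\mathrm{hi}},N}(x)-q_{\alpha_{\mathrm{hi}}}(x)|\}$. Assume 1. $\alpha_{\mathrm{hi}}-\alpha_{\mathrm{lo}}=1-\alpha$; 2. for $P_X$-almost every $x$, the law of $Y$ given $X=x$ has on $[q_{\alpha_{\mathrm{lo}}}(x)-r,q_{\alpha_{\mathrm{lo}}}(x)+r]\cup[q_{\alpha_{\mathrm{hi}}}(x)-r,q_{\alpha_{\mathrm{hi}}}(x)+r]$ a Lebesgue density with values in $[b_1,b_2]$; 3. $\mathbb P_{X\sim Q_X}(w(X)<\infty)=1$ (that is, $Q_X\ll P_X$), and $(\mathbb E[\hat w_N(X)^{1+\delta}])^{1/(1+\delta)}\le M$ for all $N$; 4. $\lim_{N\to\infty}\mathbb E[\hat w_N(X)H_N^k(X)]=\lim_{N\to\infty}\mathbb E[w(X)H_N^\ell(X)]=0$. Let $\delta'=\min\{\delta,1\}$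 and $$R_{N,n}=\frac{(\log n)^{(1+\delta')/(2(2+\delta'))}}{n^{\delta'/(2+\delta')}}+\left(\mathbb E[\hat w_N(X)H_N^k(X)]\right)^{1/(2+k)}.$$ (a) There is a constant $B_1$ depending only on $r,b_1,b_2,\delta,M,k,\ell$ such that, for all $N$ and all $n\ge2$, $$\mathbb P_{(X,Y)\sim Q_X\times P_{Y\mid X}}\big(Y\in\hat C_{N,n}(X)\big)\ \ge\ 1-\alpha-B_1\left\{R_{N,n}+\left(\mathbb E[w(X)H_N^\ell(X)]\right)^{1/(1+\ell)}\right\},$$ the probability being over both folds and an independent $(X,Y)$. (b) For every $\beta\in(0,1)$ there is a constant $B_2$ depending only on $r,b_1,b_2,\delta,M,k,\ell,\beta$ such that, for all $N$ and all $n\ge2$, both of the following hold. * With probability at least $1-\beta$ over $\mathcal Z_{\mathrm{tr}}$ and an independent $X\sim Q_X$, $$\mathbb P\big(Y\in\hat C_{N,n}(X)\mid X,\mathcal Z_{\mathrm{tr}}\big)\ \ge\ 1-\alpha-B_2\left\{R_{N,n}+\left(\mathbb E[w(X)H_N^\ell(X)]\right)^{1/\ell}\right\}.$$ * With probability at least $1-\beta$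 over $X\sim Q_X$, $$\mathbb P\big(Y\in\hat C_{N,n}(X)\mid X\big)\ \ge\ 1-\alpha-B_2\left\{R_{N,n}+\left(\mathbb E[w(X)H_N^\ell(X)]\right)^{1/\max\{1,\ell\}}\right\},$$ where both folds are averaged over. -/

import Mathlib

open MeasureTheory ProbabilityTheory Filter Topology
open scoped ENNReal NNReal

universe u

noncomputable section

/-- The quantile `inf {z : F(z) ≥ β}` of a measure on the extended real line, where
`F(z) = μ((-∞, z])`.  (The infimum of the empty set is `+∞`.) -/
def equantile (β : ℝ) (μ : Measure EReal) : EReal :=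
  sInf {z : EReal | ENNReal.ofReal β ≤ μ (Set.Iic z)}

/-- The conditional quantile `q_β(x) = inf {z : P(Y ≤ z | X = x) ≥ β}` of the conditional
law `κ x` of `Y` given `X = x`; a genuine real number for `0 < β < 1`. -/
def condQuantile {𝒳 : Type u} [MeasurableSpace 𝒳] (κ : Kernel 𝒳 ℝ) (β : ℝ) (x : 𝒳) : ℝ :=
  sInf {z : ℝ | β ≤ cdf (κ x) z}

/-- The measure `μ` has, on the set `s`, a Lebesgue density with values in `[b₁, b₂]`. -/
def HasDensityBetweenOn (μ : Measure ℝ) (s : Set ℝ) (b₁ b₂ : ℝ) : Prop :=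
  ∃ p : ℝ → ℝ, Measurable p ∧ (∀ y ∈ s, b₁ ≤ p y ∧ p y ≤ b₂) ∧
    μ.restrict s = (volume.restrict s).withDensity (fun y => ENNReal.ofReal (p y))

/-- A sample of `m` pairs `(X_i, Y_i)`. -/
abbrev Sample (𝒳 : Type u) (m : ℕ) : Type u := Fin m → 𝒳 × ℝ

section Algorithm

variable {𝒳 : Type u} {n : ℕ}

/-- The score `max {q_lo(x) - y, y - q_hi(x)}`. -/
def cqrScore (qlo qhi : 𝒳 → ℝ) (p : 𝒳 × ℝ) : ℝ :=
  max (qlo p.1 - p.2) (p.2 - qhi p.1)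

/-- The weight `p_i(x) = W_i / (∑ W_j + w(x))` of the `i`-th calibration point.
(It is `0` when `w x = ∞`.) -/
def calWeight (w : 𝒳 → ℝ≥0∞) (ca : Sample 𝒳 n) (x : 𝒳) (i : Fin n) : ℝ≥0∞ :=
  w (ca i).1 / (∑ j, w (ca j).1 + w x)

open Classical in
/-- The weight `p_∞(x) = w(x) / (∑ W_j + w(x))`, with value `1` when `w x = ∞`. -/
def inftyWeight (w : 𝒳 → ℝ≥0∞) (ca : Sample 𝒳 n) (x : 𝒳) : ℝ≥0∞ :=
  if w x = ∞ then 1 else w x / (∑ j, w (ca j).1 + w x)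

/-- The random distribution `∑ p_i(x) δ_{V_i} + p_∞(x) δ_∞`. -/
def weightedScoreLaw (qlo qhi : 𝒳 → ℝ) (w : 𝒳 → ℝ≥0∞) (ca : Sample 𝒳 n) (x : 𝒳) :
    Measure EReal :=
  (∑ i, calWeight w ca x i • Measure.dirac ((cqrScore qlo qhi (ca i) : ℝ) : EReal)) +
    inftyWeight w ca x • Measure.dirac (⊤ : EReal)

/-- The correction `η(x)`, the `(1 - α)`-th quantile of the weighted score distribution. -/
def cqrCorrection (α : ℝ) (qlo qhi : 𝒳 → ℝ) (w : 𝒳 → ℝ≥0∞) (ca : Sample 𝒳 n) (x : 𝒳) :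
    EReal :=
  equantile (1 - α) (weightedScoreLaw qlo qhi w ca x)

/-- The output `[q_lo(x) - η(x), q_hi(x) + η(x)]` of weighted split-CQR, given the functions
`qlo, qhi, w` fitted on the training fold, the calibration fold `ca` and the test point `x`. -/
def cqrInterval (α : ℝ) (qlo qhi : 𝒳 → ℝ) (w : 𝒳 → ℝ≥0∞) (ca : Sample 𝒳 n) (x : 𝒳) :
    Set ℝ :=
  {y : ℝ | (qlo x : EReal) - cqrCorrection α qlo qhi w ca x ≤ (y : EReal) ∧
    (y : EReal) ≤ (qhi x : EReal) + cqrCorrection α qlo qhi w ca x}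

end Algorithm

/-- A covariate shift problem with covariates in `𝒳` and a real outcome, together with the
levels and the fitting procedures used by weighted split-CQR. -/
structure CQRProblem (𝒳 : Type u) [MeasurableSpace 𝒳] where
  /-- covariate law of the observed data -/
  PX : Measure 𝒳
  /-- target covariate law -/
  QX : Measure 𝒳
  /-- conditional law of `Y` given `X` -/
  PYX : Kernel 𝒳 ℝ
  isProb_PX : IsProbabilityMeasure PX
  isProb_QX : IsProbabilityMeasure QX
  isMarkov_PYX : IsMarkovKernel PYX
  /-- miscoverage level -/
  α : ℝ
  /-- lower quantile level -/
  αlo : ℝ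
  /-- upper quantile level -/
  αhi : ℝ
  α_mem : α ∈ Set.Ioo (0 : ℝ) 1
  αlo_mem : αlo ∈ Set.Ioo (0 : ℝ) 1
  αhi_mem : αhi ∈ Set.Ioo (0 : ℝ) 1
  /-- estimate of the `αlo`-th conditional quantile from a training fold of size `N` -/
  qLo : (N : ℕ) → Sample 𝒳 N → 𝒳 → ℝ
  /-- estimate of the `αhi`-th conditional quantile from a training fold of size `N` -/
  qHi : (N : ℕ) → Sample 𝒳 N → 𝒳 → ℝ
  /-- estimate, up to scale, of the weight function from a training fold of size `N` -/
  wRaw : (N : ℕ) → Sample 𝒳 N → 𝒳 → ℝ≥0∞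
  measurable_qLo : ∀ N, Measurable (Function.uncurry (qLo N))
  measurable_qHi : ∀ N, Measurable (Function.uncurry (qHi N))
  measurable_wRaw : ∀ N, Measurable (Function.uncurry (wRaw N))

namespace CQRProblem

variable {𝒳 : Type u} [MeasurableSpace 𝒳] (S : CQRProblem 𝒳)

instance : IsProbabilityMeasure S.PX := S.isProb_PX
instance : IsProbabilityMeasure S.QX := S.isProb_QX
instance : IsMarkovKernel S.PYX := S.isMarkov_PYX

/-- The law of `m` i.i.d. pairs `(X_i, Y_i) ∼ P_X × P_{Y|X}`. -/
def sampleLaw (m : ℕ) : Measure (Sample 𝒳 m) :=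
  Measure.pi (fun _ : Fin m => S.PX ⊗ₘ S.PYX)

/-- The likelihood ratio `w = dQ_X / dP_X`. -/
def w : 𝒳 → ℝ≥0∞ := S.QX.rnDeriv S.PX

/-- The normalized weight estimate `ŵ_N(x) / E[ŵ_N(X) | Z_tr]`. -/
def wHat (N : ℕ) (tr : Sample 𝒳 N) (x : 𝒳) : ℝ≥0∞ :=
  S.wRaw N tr x / ∫⁻ x', S.wRaw N tr x' ∂S.PX

/-- The quantile estimation error `H_N(x)`. -/
def H (N : ℕ) (tr : Sample 𝒳 N) (x : 𝒳) : ℝ :=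
  max |S.qLo N tr x - condQuantile S.PYX S.αlo x| |S.qHi N tr x - condQuantile S.PYX S.αhi x|

/-- `E[ŵ_N(X)^s]`, the expectation being over the training fold and an independent
`X ∼ P_X`. -/
def wHatMoment (N : ℕ) (s : ℝ) : ℝ≥0∞ :=
  ∫⁻ p, S.wHat N p.1 p.2 ^ s ∂((S.sampleLaw N).prod S.PX)

/-- `E[ŵ_N(X) H_N(X)^k]`, the expectation being over the training fold and an independent
`X ∼ P_X`. -/
def wHatErr (N : ℕ) (k : ℝ) : ℝ≥0∞ :=
  ∫⁻ p, S.wHat N p.1 p.2 * ENNReal.ofReal (S.H N p.1 p.2) ^ k ∂((S.sampleLaw N).prod S.PX)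

/-- `E[w(X) H_N(X)^ℓ]`, the expectation being over the training fold and an independent
`X ∼ P_X`. -/
def wErr (N : ℕ) (ℓ : ℝ) : ℝ≥0∞ :=
  ∫⁻ p, S.w p.2 * ENNReal.ofReal (S.H N p.1 p.2) ^ ℓ ∂((S.sampleLaw N).prod S.PX)

/-- The weighted split-CQR interval `Ĉ_{N,n}(x)`. -/
def interval {N n : ℕ} (tr : Sample 𝒳 N) (ca : Sample 𝒳 n) (x : 𝒳) : Set ℝ :=
  cqrInterval S.α (S.qLo N tr) (S.qHi N tr) (S.wHat N tr) ca x

/-- The marginal coverage `P(Y ∈ Ĉ_{N,n}(X))`: training fold, calibration fold and test point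
`(X, Y) ∼ Q_X × P_{Y|X}` are independent. -/
def coverage (N n : ℕ) : ℝ≥0∞ :=
  ((S.sampleLaw N).prod ((S.sampleLaw n).prod (S.QX ⊗ₘ S.PYX)))
    {ω | ω.2.2.2 ∈ S.interval ω.1 ω.2.1 ω.2.2.1}

/-- The conditional coverage `P(Y ∈ Ĉ_{N,n}(X) | X = x)`, averaged over both folds. -/
def coverageGivenX (N n : ℕ) (x : 𝒳) : ℝ≥0∞ :=
  ((S.sampleLaw N).prod ((S.sampleLaw n).prod (S.PYX x)))
    {ω | ω.2.2 ∈ S.interval ω.1 ω.2.1 x}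

/-- The conditional coverage `P(Y ∈ Ĉ_{N,n}(X) | X = x, Z_tr = tr)`, averaged over the
calibration fold. -/
def coverageGivenXTrain {N : ℕ} (n : ℕ) (tr : Sample 𝒳 N) (x : 𝒳) : ℝ≥0∞ :=
  ((S.sampleLaw n).prod (S.PYX x)) {ω | ω.2 ∈ S.interval tr ω.1 x}

/-- The assumptions on the problem with constants `r, b₁, b₂, δ, M, k, ℓ`. -/
structure Assumptions (r b₁ b₂ δ M k ℓ : ℝ) : Prop where
  /-- the weight estimate can be normalized to have mean one under `P_X` -/
  normalizable : ∀ N, ∀ᵐ tr ∂S.sampleLaw N,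
    (∫⁻ x, S.wRaw N tr x ∂S.PX) ≠ 0 ∧ (∫⁻ x, S.wRaw N tr x ∂S.PX) ≠ ∞
  levels : S.αhi - S.αlo = 1 - S.α
  density : ∀ᵐ x ∂S.PX, HasDensityBetweenOn (S.PYX x)
    (Set.Icc (condQuantile S.PYX S.αlo x - r) (condQuantile S.PYX S.αlo x + r) ∪
      Set.Icc (condQuantile S.PYX S.αhi x - r) (condQuantile S.PYX S.αhi x + r)) b₁ b₂
  /-- the likelihood ratio `dQ_X / dP_X` is finite `Q_X`-almost surely -/
  absCont : S.QX ≪ S.PX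
  moment : ∀ N, S.wHatMoment N (1 + δ) ^ (1 / (1 + δ)) ≤ ENNReal.ofReal M
  wHatErr_tendsto : Tendsto (fun N => S.wHatErr N k) atTop (𝓝 0)
  wErr_tendsto : Tendsto (fun N => S.wErr N ℓ) atTop (𝓝 0)

end CQRProblem

/-- The rate `(log n)^{(1+δ') / (2(2+δ'))} / n^{δ' / (2+δ')}` with `δ' = min {δ, 1}`. -/
def calRate (δ : ℝ) (n : ℕ) : ℝ≥0∞ :=
  ENNReal.ofReal (Real.log n ^ ((1 + min δ 1) / (2 * (2 + min δ 1))) /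
    (n : ℝ) ^ (min δ 1 / (2 + min δ 1)))

end

/-! Undercoverage needs either a correction `η(x)` well below zero or poor quantile estimates at
`x`. If `η(x) ≥ -t`, the interval contains the true quantile band shrunk by `t + H(x)` at each end,
and the upper density bound prices this at `2 b₂ (t + H(x))`.

The event `η(x) < -t` forces a weighted vote among the calibration points: those with score below
`-t` carry at least the share `1 - α` of `∑ W_i` (`vote_of_cqrCorrection_lt`). This event no longer
involves `x`. Where `H ≤ t/2`, the lower density bound makes the conditional probability of such a
score at most `1 - α - b₁ t/2`, and Markov's inequality bounds the weighted mass of the remaining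
points by a multiple of `t^(-k) E[ŵ H^k]`. So the vote has a deficit of order `t` in mean. Since
only `1 + d` moments of the weights are available, `d = min δ 1`, the weights are truncated at `τ =
n t` before Chebyshev's inequality is applied (`pi_weighted_vote_le`). The tail and variance terms
are then both of order `n^(-d) t^(-(1+d)) E[ŵ^(1+d)]`, which gives `sampleLaw_voteSet_le`.

The resulting inequality at fixed training fold and test point is
`ofReal_le_coverageGivenXTrain_add`. Its error is linear in the conditional moments given the
training fold, so averaging recovers the assumed moments. Taking `t = n^(-d/(2+d)) + E[ŵ
H^k]^(1/(2+k))` makes it of order `t`; this is better than the stated rate by the logarithm. The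
three claims differ only in how `H` is removed: by integration, by Markov's inequality in `(Z_tr,
X)`, or by Markov's inequality in `X` after averaging over the training fold. -/

/-! ### Mass of intervals under a two-sided density bound. -/

namespace HasDensityBetweenOn

variable {μ : Measure ℝ} {s I : Set ℝ} {b₁ b₂ : ℝ}

lemma measure_eq {p : ℝ → ℝ} (hI : MeasurableSet I) (hIs : I ⊆ s)
    (he : μ.restrict s = (volume.restrict s).withDensity (fun y => ENNReal.ofReal (p y))) :
    μ I = ∫⁻ y in I, ENNReal.ofReal (p y) := by
  have h := congrArg (fun ν : Measure ℝ => ν I) he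
  simpa [Measure.restrict_apply hI, Set.inter_eq_left.2 hIs, withDensity_apply _ hI,
    Measure.restrict_restrict hI] using h

lemma measure_le (h : HasDensityBetweenOn μ s b₁ b₂) (hI : MeasurableSet I) (hIs : I ⊆ s) :
    μ I ≤ ENNReal.ofReal b₂ * volume I := by
  obtain ⟨p, -, hb, he⟩ := h
  rw [measure_eq hI hIs he, ← setLIntegral_const]
  exact setLIntegral_mono' hI fun y hy => ENNReal.ofReal_le_ofReal (hb y (hIs hy)).2

lemma le_measure (h : HasDensityBetweenOn μ s b₁ b₂) (hI : MeasurableSet I) (hIs : I ⊆ s) :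
    ENNReal.ofReal b₁ * volume I ≤ μ I := by
  obtain ⟨p, -, hb, he⟩ := h
  rw [measure_eq hI hIs he, ← setLIntegral_const]
  exact setLIntegral_mono' hI fun y hy => ENNReal.ofReal_le_ofReal (hb y (hIs hy)).1

lemma real_Icc_le [IsFiniteMeasure μ] (h : HasDensityBetweenOn μ s b₁ b₂) (hb₂ : 0 ≤ b₂)
    {c d : ℝ} (hcd : c ≤ d) (hs : Set.Icc c d ⊆ s) : μ.real (Set.Icc c d) ≤ b₂ * (d - c) := by
  have := h.measure_le measurableSet_Icc hs
  rw [Real.volume_Icc, ← ENNReal.ofReal_mul hb₂] at this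
  exact ENNReal.toReal_le_of_le_ofReal (mul_nonneg hb₂ (by linarith)) this

lemma le_real_Ioc [IsFiniteMeasure μ] (h : HasDensityBetweenOn μ s b₁ b₂) (hb₁ : 0 ≤ b₁)
    {c d : ℝ} (hs : Set.Ioc c d ⊆ s) : b₁ * (d - c) ≤ μ.real (Set.Ioc c d) := by
  have := h.le_measure measurableSet_Ioc hs
  rw [Real.volume_Ioc, ← ENNReal.ofReal_mul hb₁] at this
  exact (ENNReal.ofReal_le_iff_le_toReal (measure_ne_top _ _)).1 this

lemma measure_singleton (h : HasDensityBetweenOn μ s b₁ b₂) {c : ℝ} (hc : c ∈ s) :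
    μ {c} = 0 := by
  simpa using h.measure_le (measurableSet_singleton c) (by simpa using hc)

end HasDensityBetweenOn

/-! ### Conditional quantiles: attainment, measurability, exact level. -/

section CondQuantile

variable {𝒳 : Type u} [MeasurableSpace 𝒳] (κ : Kernel 𝒳 ℝ) {β : ℝ}

/-- Right-continuity of the distribution function makes the infimum attained; the limits at `±∞`
make the set nonempty and bounded below. -/
lemma condQuantile_le_iff (hβ : β ∈ Set.Ioo (0 : ℝ) 1) (x : 𝒳) (z : ℝ) :
    condQuantile κ β x ≤ z ↔ β ≤ cdf (κ x) z := by
  have hne : {z : ℝ | β ≤ cdf (κ x) z}.Nonempty := by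
    obtain ⟨z, hz⟩ := ((tendsto_cdf_atTop (κ x)).eventually (lt_mem_nhds hβ.2)).exists
    exact ⟨z, hz.le⟩
  have hbdd : BddBelow {z : ℝ | β ≤ cdf (κ x) z} := by
    obtain ⟨a, ha⟩ := ((tendsto_cdf_atBot (κ x)).eventually (gt_mem_nhds hβ.1)).exists
    refine ⟨a, fun z hz => ?_⟩
    by_contra! hza
    exact absurd (hz.trans (monotone_cdf (κ x) hza.le)) (not_le.2 ha)
  refine ⟨fun h => ?_, fun h => csInf_le hbdd h⟩
  have hgt : ∀ y, z < y → β ≤ cdf (κ x) y := fun y hy => by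
    obtain ⟨w, hw, hwy⟩ := exists_lt_of_csInf_lt hne (lt_of_le_of_lt h hy)
    exact le_trans hw (monotone_cdf (κ x) hwy.le)
  have hc : Tendsto (cdf (κ x)) (𝓝[>] z) (𝓝 (cdf (κ x) z)) :=
    ((cdf (κ x)).right_continuous z).mono_left (nhdsWithin_mono z Set.Ioi_subset_Ici_self)
  exact ge_of_tendsto hc (eventually_nhdsWithin_of_forall hgt)

lemma measurable_condQuantile [IsMarkovKernel κ] (hβ : β ∈ Set.Ioo (0 : ℝ) 1) :
    Measurable (condQuantile κ β) := by
  refine measurable_of_Iic fun z => ?_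
  have : condQuantile κ β ⁻¹' Set.Iic z = {x | β ≤ (κ x (Set.Iic z)).toReal} := by
    ext x
    simp [condQuantile_le_iff κ hβ, cdf_eq_real, Measure.real]
  rw [this]
  exact measurableSet_le measurable_const
    (κ.measurable_coe measurableSet_Iic).ennreal_toReal

/-- The left limit of the distribution function at the quantile is at most `β`, the value there is
at least `β`, and their difference is the mass of the atom. -/
lemma measureReal_Iic_condQuantile [IsMarkovKernel κ] (hβ : β ∈ Set.Ioo (0 : ℝ) 1) {x : 𝒳}
    (h0 : κ x {condQuantile κ β x} = 0) : (κ x).real (Set.Iic (condQuantile κ β x)) = β := by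
  set q := condQuantile κ β x with hq
  have h1 : β ≤ cdf (κ x) q := (condQuantile_le_iff κ hβ x q).1 le_rfl
  have hlt : ∀ z < q, cdf (κ x) z ≤ β := fun z hz => by
    by_contra! h
    exact absurd ((condQuantile_le_iff κ hβ x z).2 h.le) (not_le.2 hz)
  have h2 : cdf (κ x) q ≤ β := by
    have hl : Function.leftLim (cdf (κ x)) q ≤ β :=
      le_of_tendsto ((monotone_cdf (κ x)).tendsto_leftLim q)
        (eventually_nhdsWithin_of_forall hlt)
    have hm := (cdf (κ x)).measure_singleton q
    rw [measure_cdf, h0] at hm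
    have := ENNReal.ofReal_eq_zero.1 hm.symm
    linarith
  rw [← cdf_eq_real]
  exact le_antisymm h2 h1

end CondQuantile

/-! ### Mass of the quantile band after shrinking or widening. -/

section Band

variable {μ : Measure ℝ} [IsProbabilityMeasure μ] {r b₁ b₂ lo hi αlo αhi : ℝ}

/-- The covering of `Iic hi` used here holds even if the shrunken band is empty, so no ordering of
its endpoints is required. -/
lemma le_measureReal_band (hb₂ : 0 ≤ b₂)
    (h : HasDensityBetweenOn μ (Set.Icc (lo - r) (lo + r) ∪ Set.Icc (hi - r) (hi + r)) b₁ b₂)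
    (hlo : μ.real (Set.Iic lo) = αlo) (hhi : μ.real (Set.Iic hi) = αhi) {s : ℝ} (hs : 0 ≤ s)
    (hsr : s ≤ r) : αhi - αlo - 2 * b₂ * s ≤ μ.real (Set.Icc (lo + s) (hi - s)) := by
  have hsub : Set.Iic hi ⊆ Set.Iic lo ∪ Set.Icc lo (lo + s) ∪ Set.Icc (hi - s) hi ∪
      Set.Icc (lo + s) (hi - s) := by
    intro y hy
    simp only [Set.mem_union, Set.mem_Iic, Set.mem_Icc] at hy ⊢
    grind
  have h1 := h.real_Icc_le hb₂ (c := lo) (d := lo + s) (by linarith)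
    ((Set.Icc_subset_Icc (by linarith) (by linarith)).trans Set.subset_union_left)
  have h2 := h.real_Icc_le hb₂ (c := hi - s) (d := hi) (by linarith)
    ((Set.Icc_subset_Icc (by linarith) (by linarith)).trans Set.subset_union_right)
  have h3 := measureReal_mono (μ := μ) hsub
  have h4 := measureReal_union_le (μ := μ)
    (Set.Iic lo ∪ Set.Icc lo (lo + s) ∪ Set.Icc (hi - s) hi) (Set.Icc (lo + s) (hi - s))
  have h5 := measureReal_union_le (μ := μ) (Set.Iic lo ∪ Set.Icc lo (lo + s)) (Set.Icc (hi - s) hi)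
  have h6 := measureReal_union_le (μ := μ) (Set.Iic lo) (Set.Icc lo (lo + s))
  nlinarith

/-- Three disjoint pieces fit inside `Iic hi`; only the strip above `lo` is counted as lost mass.
The hypothesis `hgap` ensures that this strip ends before `hi`, for otherwise it would carry the
whole mass `αhi - αlo`. -/
lemma measureReal_band_le (hb₁ : 0 ≤ b₁) (hb₂ : 0 ≤ b₂)
    (h : HasDensityBetweenOn μ (Set.Icc (lo - r) (lo + r) ∪ Set.Icc (hi - r) (hi + r)) b₁ b₂)
    (hlo : μ.real (Set.Iic lo) = αlo) (hhi : μ.real (Set.Iic hi) = αhi) {s : ℝ} (hs : 0 ≤ s)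
    (hsr : s ≤ r) (hgap : b₂ * s < αhi - αlo) :
    μ.real (Set.Ioo (lo + s) (hi - s)) ≤ αhi - αlo - b₁ * s := by
  have hlt : lo + s < hi := by
    by_contra! hle
    have hsub : Set.Iic hi ⊆ Set.Iic lo ∪ Set.Icc lo (lo + s) := by
      intro y hy
      simp only [Set.mem_union, Set.mem_Iic, Set.mem_Icc] at hy ⊢
      grind
    have h1 := h.real_Icc_le hb₂ (c := lo) (d := lo + s) (by linarith)
      ((Set.Icc_subset_Icc (by linarith) (by linarith)).trans Set.subset_union_left)
    have h3 := measureReal_mono (μ := μ) hsub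
    have h6 := measureReal_union_le (μ := μ) (Set.Iic lo) (Set.Icc lo (lo + s))
    nlinarith
  have hsub : Set.Iic lo ∪ Set.Ioc lo (lo + s) ∪ Set.Ioo (lo + s) (hi - s) ⊆ Set.Iic hi := by
    intro y hy
    simp only [Set.mem_union, Set.mem_Iic, Set.mem_Ioc, Set.mem_Ioo] at hy ⊢
    grind
  have h1 := h.le_real_Ioc hb₁ (c := lo) (d := lo + s)
    ((Set.Ioc_subset_Icc_self.trans (Set.Icc_subset_Icc (by linarith) (by linarith))).trans
      Set.subset_union_left)
  have h3 := measureReal_mono (μ := μ) hsub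
  rw [measureReal_union _ measurableSet_Ioo, measureReal_union _ measurableSet_Ioc] at h3
  · nlinarith
  · exact Set.disjoint_left.2 fun y hy hy' => by
      simp only [Set.mem_Iic, Set.mem_Ioc] at hy hy'; linarith [hy'.1]
  · exact Set.disjoint_left.2 fun y hy hy' => by
      simp only [Set.mem_union, Set.mem_Iic, Set.mem_Ioc, Set.mem_Ioo] at hy hy'; grind

end Band

/-! ### Weighted votes of i.i.d. points under a `1 + d` moment. -/

section Concentration

lemma pi_sum_nonpos_le {Ω : Type*} [MeasurableSpace Ω] (P : Measure Ω) [IsProbabilityMeasure P]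
    {f : Ω → ℝ} (hf : Measurable f) {τ a v : ℝ} (hτ : ∀ ω, |f ω| ≤ τ) (ha : 0 < a)
    (hmean : a ≤ ∫ ω, f ω ∂P) (hv : ∫ ω, f ω ^ 2 ∂P ≤ v) {n : ℕ} (hn : 0 < n) :
    (Measure.pi fun _ : Fin n => P) {ω | ∑ i, f (ω i) ≤ 0} ≤ ENNReal.ofReal (v / (n * a ^ 2)) := by
  have hn' : (0 : ℝ) < n := by exact_mod_cast hn
  have hLp : MemLp f 2 P :=
    MemLp.of_bound hf.aestronglyMeasurable τ (Eventually.of_forall hτ)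
  have hLpi : ∀ i : Fin n, MemLp (fun ω : Fin n → Ω => f (ω i)) 2 (Measure.pi fun _ => P) :=
    fun i => hLp.comp_measurePreserving (measurePreserving_eval (fun _ : Fin n => P) i)
  have hS : MemLp (∑ i, fun ω : Fin n → Ω => f (ω i)) 2 (Measure.pi fun _ => P) :=
    memLp_finsetSum' _ fun i _ => hLpi i
  have hvar : Var[∑ i, fun ω : Fin n → Ω => f (ω i); Measure.pi fun _ => P] ≤ n * v := by
    rw [variance_sum_pi fun _ => hLp]
    simp only [Finset.sum_const, Finset.card_univ, Fintype.card_fin, nsmul_eq_mul]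
    gcongr
    exact (variance_le_expectation_sq hf.aestronglyMeasurable).trans hv
  have hexp : ∫ ω, (∑ i, fun ω : Fin n → Ω => f (ω i)) ω ∂(Measure.pi fun _ => P) =
      n * ∫ ω, f ω ∂P := by
    simp only [Finset.sum_apply]
    rw [integral_finsetSum _ fun i _ => (hLpi i).integrable (by norm_num)]
    have : ∀ i : Fin n, ∫ ω : Fin n → Ω, f (ω i) ∂(Measure.pi fun _ => P) = ∫ ω, f ω ∂P :=
      fun i => integral_comp_eval (μ := fun _ : Fin n => P) hf.aestronglyMeasurable
    simp [this]
  refine (measure_mono ?_).trans ((meas_ge_le_variance_div_sq hS (c := n * a)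
    (by positivity)).trans (ENNReal.ofReal_le_ofReal ?_))
  · intro ω hω
    simp only [Set.mem_ofPred_eq] at hω ⊢
    rw [hexp, abs_sub_comm]
    refine le_trans ?_ (le_abs_self _)
    have := mul_le_mul_of_nonneg_left hmean hn'.le
    simp only [Finset.sum_apply]
    linarith
  · calc _ ≤ n * v / (n * a) ^ 2 := by gcongr
      _ = v / (n * a ^ 2) := by field_simp

lemma rpow_mul_le_rpow_one_add {d : ℝ} (hd : 0 ≤ d) {t w : ℝ≥0∞} (h : t ≤ w) :
    t ^ d * w ≤ w ^ (1 + d) := by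
  rw [ENNReal.rpow_add_of_nonneg _ _ zero_le_one hd, ENNReal.rpow_one, mul_comm]
  gcongr

section truncWeight

variable {𝒳 : Type*}

/-- The weight `w`, replaced by `0` above the level `τ`. -/
noncomputable def truncWeight (w : 𝒳 → ℝ≥0∞) (τ : ℝ) (x : 𝒳) : ℝ :=
  {x | w x ≤ ENNReal.ofReal τ}.indicator (fun x => (w x).toReal) x

variable {w : 𝒳 → ℝ≥0∞} {τ : ℝ}

lemma measurable_truncWeight [MeasurableSpace 𝒳] (hw : Measurable w) : Measurable (truncWeight w τ) :=
  hw.ennreal_toReal.indicator (measurableSet_le hw measurable_const)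

lemma truncWeight_nonneg (x : 𝒳) : 0 ≤ truncWeight w τ x :=
  Set.indicator_nonneg (fun _ _ => ENNReal.toReal_nonneg) x

lemma truncWeight_of_le {x : 𝒳} (h : w x ≤ ENNReal.ofReal τ) :
    truncWeight w τ x = (w x).toReal := Set.indicator_of_mem (s := {x | w x ≤ ENNReal.ofReal τ}) h _

lemma truncWeight_of_gt {x : 𝒳} (h : ENNReal.ofReal τ < w x) :
    truncWeight w τ x = 0 :=
  Set.indicator_of_notMem (s := {x | w x ≤ ENNReal.ofReal τ}) (not_le.2 h) _

lemma truncWeight_le (hτ : 0 ≤ τ) (x : 𝒳) : truncWeight w τ x ≤ τ := by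
  rcases le_or_gt (w x) (ENNReal.ofReal τ) with h | h
  · rw [truncWeight_of_le h]
    exact ENNReal.toReal_le_of_le_ofReal hτ h
  · rwa [truncWeight_of_gt h]

lemma ofReal_truncWeight_le (x : 𝒳) : ENNReal.ofReal (truncWeight w τ x) ≤ w x := by
  rcases le_or_gt (w x) (ENNReal.ofReal τ) with h | h
  · rw [truncWeight_of_le h]
    exact ENNReal.ofReal_toReal_le
  · simp [truncWeight_of_gt h]

/-- What truncation discards lies above `τ`, where `1 ≤ (w / τ)^d`. This controls the bias of the
truncated mean. -/
lemma le_ofReal_truncWeight_add (hτ : 0 < τ) {d : ℝ} (hd : 0 ≤ d) (x : 𝒳) :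
    w x ≤ ENNReal.ofReal (truncWeight w τ x) + ENNReal.ofReal (τ ^ (-d)) * w x ^ (1 + d) := by
  rcases le_or_gt (w x) (ENNReal.ofReal τ) with h | h
  · rw [truncWeight_of_le h, ENNReal.ofReal_toReal (ne_top_of_le_ne_top ENNReal.ofReal_ne_top h)]
    exact le_self_add
  · refine le_trans ?_ le_add_self
    calc w x = ENNReal.ofReal (τ ^ (-d)) * (ENNReal.ofReal τ ^ d * w x) := by
          rw [← mul_assoc, ENNReal.ofReal_rpow_of_pos hτ, ← ENNReal.ofReal_mul (by positivity),
            ← Real.rpow_add hτ]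
          simp
      _ ≤ _ := by
          gcongr
          exact rpow_mul_le_rpow_one_add hd h.le

/-- Of the two powers of the truncated weight, `1 - d` are bounded by the level `τ`; this is where
`d ≤ 1` enters. -/
lemma ofReal_truncWeight_sq_le (hτ : 0 < τ) {d : ℝ} (hd : 0 ≤ d) (hd1 : d ≤ 1) (x : 𝒳) :
    ENNReal.ofReal (truncWeight w τ x ^ 2) ≤ ENNReal.ofReal (τ ^ (1 - d)) * w x ^ (1 + d) := by
  have h0 : 0 ≤ truncWeight w τ x := truncWeight_nonneg x
  calc ENNReal.ofReal (truncWeight w τ x ^ 2)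
      = ENNReal.ofReal (truncWeight w τ x ^ (1 - d) * truncWeight w τ x ^ (1 + d)) := by
        rw [← Real.rpow_add_of_nonneg h0 (by linarith) (by linarith)]
        norm_num
    _ = ENNReal.ofReal (truncWeight w τ x ^ (1 - d)) *
        ENNReal.ofReal (truncWeight w τ x) ^ (1 + d) := by
        rw [ENNReal.ofReal_mul (by positivity),
          ENNReal.ofReal_rpow_of_nonneg h0 (by linarith : 0 ≤ 1 + d)]
    _ ≤ _ := by
        gcongr
        · exact truncWeight_le hτ.le x
        · exact ofReal_truncWeight_le x

end truncWeight

variable {𝒳 : Type*} [MeasurableSpace 𝒳]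

/-- Under conditional probabilities at most `c - γ` outside of an exceptional set `B`, a weighted
vote of `n` i.i.d. points in favour of `A` rarely reaches the share `c`. -/
lemma pi_weighted_vote_le (P : Measure 𝒳) [IsProbabilityMeasure P] (κ : Kernel 𝒳 ℝ)
    [IsMarkovKernel κ] {w : 𝒳 → ℝ≥0∞} (hw : Measurable w) (hw1 : ∫⁻ x, w x ∂P = 1)
    {A : Set (𝒳 × ℝ)} (hA : MeasurableSet A) {B : Set 𝒳} (hB : MeasurableSet B)
    {c γ d m e τ : ℝ} (hc0 : 0 ≤ c) (hc1 : c ≤ 1) (hγ : 0 < γ) (hd : 0 ≤ d) (hd1 : d ≤ 1)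
    (hm0 : 0 ≤ m) (he0 : 0 ≤ e) (hτ : 0 < τ)
    (hAB : ∀ᵐ x ∂P, x ∉ B → (κ x).real (Prod.mk x ⁻¹' A) ≤ c - γ)
    (hm : ∫⁻ x, w x ^ (1 + d) ∂P ≤ ENNReal.ofReal m) (he : ∫⁻ x in B, w x ∂P ≤ ENNReal.ofReal e)
    (hmτ : τ ^ (-d) * m ≤ 1 / 4) (heγ : (1 + γ) * e ≤ γ / 4) {n : ℕ} (hn : 0 < n) :
    (Measure.pi fun _ : Fin n => P ⊗ₘ κ)
        {ω | ENNReal.ofReal c * ∑ i, w (ω i).1 ≤ ∑ i, A.indicator (fun p => w p.1) (ω i)} ≤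
      ENNReal.ofReal (n * (τ ^ (-(1 + d)) * m) + τ ^ (1 - d) * m / (n * (γ / 2) ^ 2)) := by
  -- If no weight exceeds `τ`, the vote reaches the share `c` exactly when `∑ f ≤ 0`.
  set f : 𝒳 × ℝ → ℝ := fun p => truncWeight w τ p.1 * (c - A.indicator 1 p) with hf
  have hfm : Measurable f := ((measurable_truncWeight hw).comp measurable_fst).mul
    (measurable_const.sub (measurable_one.indicator hA))
  have hind : ∀ p, |c - A.indicator (1 : 𝒳 × ℝ → ℝ) p| ≤ 1 := fun p => by
    by_cases hp : p ∈ A <;> simp [hp, abs_le] <;> constructor <;> linarith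
  have hft : ∀ p, |f p| ≤ truncWeight w τ p.1 := fun p => by
    rw [hf, abs_mul, abs_of_nonneg (truncWeight_nonneg _)]
    exact mul_le_of_le_one_right (truncWeight_nonneg _) (hind p)
  have hfτ : ∀ p, |f p| ≤ τ := fun p => (hft p).trans (truncWeight_le hτ.le _)
  have hti : Integrable (truncWeight w τ) P :=
    Integrable.of_bound (measurable_truncWeight hw).aestronglyMeasurable τ
      (Eventually.of_forall fun x => by
        rw [Real.norm_of_nonneg (truncWeight_nonneg _)]
        exact truncWeight_le hτ.le x)
  have hfi : Integrable f (P ⊗ₘ κ) :=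
    Integrable.of_bound hfm.aestronglyMeasurable τ (Eventually.of_forall hfτ)
  have hmean1 : 3 / 4 ≤ ∫ x, truncWeight w τ x ∂P := by
    rw [integral_eq_lintegral_of_nonneg_ae (Eventually.of_forall truncWeight_nonneg)
      hti.aestronglyMeasurable]
    have h1 : (1 : ℝ≥0∞) ≤ ∫⁻ x, ENNReal.ofReal (truncWeight w τ x) ∂P +
        ENNReal.ofReal (1 / 4) := by
      calc (1 : ℝ≥0∞) = ∫⁻ x, w x ∂P := hw1.symm
        _ ≤ ∫⁻ x, (ENNReal.ofReal (truncWeight w τ x) +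
            ENNReal.ofReal (τ ^ (-d)) * w x ^ (1 + d)) ∂P :=
          lintegral_mono fun x => le_ofReal_truncWeight_add hτ hd x
        _ = ∫⁻ x, ENNReal.ofReal (truncWeight w τ x) ∂P +
            ENNReal.ofReal (τ ^ (-d)) * ∫⁻ x, w x ^ (1 + d) ∂P := by
          rw [lintegral_add_left (measurable_truncWeight hw).ennreal_ofReal,
            lintegral_const_mul _ (hw.pow_const _)]
        _ ≤ _ := by
          gcongr
          refine (mul_le_mul_right hm _).trans ?_
          rw [← ENNReal.ofReal_mul (by positivity)]
          exact ENNReal.ofReal_le_ofReal hmτ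
    have hfin : ∫⁻ x, ENNReal.ofReal (truncWeight w τ x) ∂P ≠ ∞ :=
      ne_top_of_le_ne_top ENNReal.one_ne_top
        ((lintegral_mono fun x => ofReal_truncWeight_le x).trans hw1.le)
    have := ENNReal.toReal_mono (by finiteness) h1
    rw [ENNReal.toReal_add hfin ENNReal.ofReal_ne_top, ENNReal.toReal_ofReal (by norm_num)] at this
    simp only [ENNReal.toReal_one] at this
    linarith
  have hmean2 : ∫ x in B, truncWeight w τ x ∂P ≤ e := by
    rw [integral_eq_lintegral_of_nonneg_ae (Eventually.of_forall truncWeight_nonneg)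
      hti.aestronglyMeasurable.restrict]
    exact ENNReal.toReal_le_of_le_ofReal he0
      ((lintegral_mono fun x => ofReal_truncWeight_le x).trans he)
  -- Conditionally on `x`, the factor `c - 1_A` has mean at least `γ` off `B` and at least `-1 = γ -
  -- (1 + γ)` on `B`. Hence the mean of `f` is at least `γ * (3/4) - (1 + γ) * e ≥ γ / 2`.
  have hmean : γ / 2 ≤ ∫ p, f p ∂(P ⊗ₘ κ) := by
    rw [Measure.integral_compProd hfi]
    have hinner : ∀ x, ∫ y, f (x, y) ∂κ x =
        truncWeight w τ x * (c - (κ x).real (Prod.mk x ⁻¹' A)) := fun x => by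
      have hmA : MeasurableSet (Prod.mk x ⁻¹' A) := measurable_prodMk_left hA
      have h1 : ∀ y, f (x, y) = truncWeight w τ x * (c - (Prod.mk x ⁻¹' A).indicator 1 y) :=
        fun y => rfl
      simp only [h1]
      have hi : Integrable ((Prod.mk x ⁻¹' A).indicator (1 : ℝ → ℝ)) (κ x) :=
        (integrable_const (1 : ℝ)).indicator hmA
      rw [integral_const_mul, integral_sub (integrable_const _) hi, integral_indicator_one hmA]
      simp
    calc γ / 2 ≤ γ * ∫ x, truncWeight w τ x ∂P - (1 + γ) * ∫ x in B, truncWeight w τ x ∂P := by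
          nlinarith
      _ = ∫ x, (γ * truncWeight w τ x - (1 + γ) * B.indicator (truncWeight w τ) x) ∂P := by
          rw [integral_sub (hti.const_mul _) ((hti.indicator hB).const_mul _),
            integral_const_mul, integral_const_mul, integral_indicator hB]
      _ ≤ ∫ x, ∫ y, f (x, y) ∂κ x ∂P := by
          refine integral_mono_ae ((hti.const_mul _).sub ((hti.indicator hB).const_mul _))
            hfi.integral_compProd ?_
          filter_upwards [hAB] with x hx
          simp only [hinner]
          have h0 := truncWeight_nonneg (w := w) (τ := τ) x
          by_cases hxB : x ∈ B
          · have : (κ x).real (Prod.mk x ⁻¹' A) ≤ 1 := measureReal_le_one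
            simp only [hxB, Set.indicator_of_mem]
            nlinarith
          · have := hx hxB
            simp only [hxB, not_false_eq_true, Set.indicator_of_notMem]
            nlinarith
  have hsq : ∫ p, f p ^ 2 ∂(P ⊗ₘ κ) ≤ τ ^ (1 - d) * m := by
    rw [integral_eq_lintegral_of_nonneg_ae (Eventually.of_forall fun p => sq_nonneg _)
      (hfm.pow_const 2).aestronglyMeasurable]
    refine ENNReal.toReal_le_of_le_ofReal (by positivity) ?_
    calc ∫⁻ p, ENNReal.ofReal (f p ^ 2) ∂(P ⊗ₘ κ)
        ≤ ∫⁻ p, ENNReal.ofReal (τ ^ (1 - d)) * w p.1 ^ (1 + d) ∂(P ⊗ₘ κ) := by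
          refine lintegral_mono fun p => le_trans (ENNReal.ofReal_le_ofReal ?_)
            (ofReal_truncWeight_sq_le hτ hd hd1 p.1)
          exact sq_le_sq' (abs_le.1 (hft p)).1 (abs_le.1 (hft p)).2
      _ = ∫⁻ x, ENNReal.ofReal (τ ^ (1 - d)) * w x ^ (1 + d) ∂P := by
          rw [Measure.lintegral_compProd (by fun_prop)]
          simp
      _ ≤ _ := by
          rw [lintegral_const_mul _ (hw.pow_const _), ENNReal.ofReal_mul (by positivity)]
          gcongr
  have htail : P {x | ENNReal.ofReal τ < w x} ≤ ENNReal.ofReal (τ ^ (-(1 + d)) * m) := by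
    have h1 := mul_meas_ge_le_lintegral (μ := P) (hw.pow_const (1 + d)) (ENNReal.ofReal τ ^ (1 + d))
    have h2 : P {x | ENNReal.ofReal τ < w x} ≤
        P {x | ENNReal.ofReal τ ^ (1 + d) ≤ w x ^ (1 + d)} :=
      measure_mono fun x hx => ENNReal.rpow_le_rpow (le_of_lt hx) (by linarith)
    calc P {x | ENNReal.ofReal τ < w x}
        = ENNReal.ofReal (τ ^ (-(1 + d))) *
          (ENNReal.ofReal τ ^ (1 + d) * P {x | ENNReal.ofReal τ < w x}) := by
          rw [← mul_assoc, ENNReal.ofReal_rpow_of_pos hτ, ← ENNReal.ofReal_mul (by positivity),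
            ← Real.rpow_add hτ]
          simp
      _ ≤ _ := by
          rw [ENNReal.ofReal_mul (by positivity)]
          gcongr
          exact ((mul_le_mul_right h2 _).trans h1).trans hm
  -- Either some weight exceeds `τ`, which a union bound handles, or all weights are finite and
  -- untouched by truncation, so the vote can be rewritten over the reals.
  have hsub : {ω : Fin n → 𝒳 × ℝ | ENNReal.ofReal c * ∑ i, w (ω i).1 ≤
      ∑ i, A.indicator (fun p => w p.1) (ω i)} ⊆
      (⋃ i, (fun ω => ω i) ⁻¹' {p : 𝒳 × ℝ | ENNReal.ofReal τ < w p.1}) ∪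
        {ω | ∑ i, f (ω i) ≤ 0} := by
    intro ω hω
    by_cases hex : ∃ i, ENNReal.ofReal τ < w (ω i).1
    · exact Or.inl (by simpa using hex)
    refine Or.inr ?_
    push Not at hex
    have hne : ∀ i, w (ω i).1 ≠ ∞ := fun i => ne_top_of_le_ne_top ENNReal.ofReal_ne_top (hex i)
    have hne' : ∀ i, A.indicator (fun p => w p.1) (ω i) ≠ ∞ := fun i =>
      ne_top_of_le_ne_top (hne i) (Set.indicator_le_self' (fun _ _ => zero_le) _)
    have := ENNReal.toReal_mono (ENNReal.sum_ne_top.2 fun i _ => hne' i) hω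
    rw [ENNReal.toReal_mul, ENNReal.toReal_ofReal hc0, ENNReal.toReal_sum fun i _ => hne i,
      ENNReal.toReal_sum fun i _ => hne' i, Finset.mul_sum, ← sub_nonpos,
      ← Finset.sum_sub_distrib] at this
    refine le_of_eq_of_le (Finset.sum_congr rfl fun i _ => ?_) this
    simp only [hf, truncWeight_of_le (hex i)]
    by_cases hi : ω i ∈ A <;> simp [hi] <;> ring
  refine (measure_mono hsub).trans ((measure_union_le _ _).trans ?_)
  rw [ENNReal.ofReal_add (by positivity) (by positivity)]
  gcongr
  · refine (measure_iUnion_le _).trans ?_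
    have hS : MeasurableSet {p : 𝒳 × ℝ | ENNReal.ofReal τ < w p.1} :=
      measurableSet_lt measurable_const (hw.comp measurable_fst)
    have hev : ∀ i : Fin n, (Measure.pi fun _ : Fin n => P ⊗ₘ κ)
        ((fun ω => ω i) ⁻¹' {p : 𝒳 × ℝ | ENNReal.ofReal τ < w p.1}) =
        P {x | ENNReal.ofReal τ < w x} := fun i => by
      rw [(measurePreserving_eval (fun _ : Fin n => P ⊗ₘ κ) i).measure_preimage
        hS.nullMeasurableSet]
      conv_rhs => rw [← Measure.fst_compProd P κ]
      rw [Measure.fst_apply (measurableSet_lt measurable_const hw)]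
      rfl
    simp only [hev, tsum_fintype, Finset.sum_const, Finset.card_univ, Fintype.card_fin,
      nsmul_eq_mul]
    rw [ENNReal.ofReal_mul (by positivity), ENNReal.ofReal_natCast]
    gcongr
  · exact pi_sum_nonpos_le (P ⊗ₘ κ) hfm hfτ (by positivity) hmean hsq hn

end Concentration

/-! ### From the correction to a vote, and to membership in the interval. -/

section Correction

variable {𝒳 : Type u} {n : ℕ} {α t : ℝ} {qlo qhi : 𝒳 → ℝ} {w : 𝒳 → ℝ≥0∞} {ca : Sample 𝒳 n}
  {x : 𝒳}

/-- Some `z < -t` already carries mass `1 - α`, and the atom at `∞` contributes nothing to it.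
Clearing the common denominator and dropping `w x` from it leaves a condition on the calibration
fold alone. -/
lemma vote_of_cqrCorrection_lt (h : cqrCorrection α qlo qhi w ca x < ((-t : ℝ) : EReal)) :
    ENNReal.ofReal (1 - α) * ∑ i, w (ca i).1 ≤
      ∑ i, {p | cqrScore qlo qhi p < -t}.indicator (fun p => w p.1) (ca i) := by
  obtain ⟨z, hz, hzt⟩ := sInf_lt_iff.1 h
  have hztop : z ≠ ⊤ := (hzt.trans (EReal.coe_lt_top _)).ne
  have hle : weightedScoreLaw qlo qhi w ca x (Set.Iic z) ≤
      (∑ i, {p | cqrScore qlo qhi p < -t}.indicator (fun p => w p.1) (ca i)) /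
        (∑ j, w (ca j).1 + w x) := by
    simp only [weightedScoreLaw, Measure.coe_add, Pi.add_apply, Measure.finsetSum_apply,
      Measure.smul_apply, smul_eq_mul, Measure.dirac_apply' _ measurableSet_Iic]
    rw [Set.indicator_of_notMem (by simpa using hztop), mul_zero, add_zero, div_eq_mul_inv,
      Finset.sum_mul]
    refine Finset.sum_le_sum fun i _ => ?_
    by_cases hi : ((cqrScore qlo qhi (ca i) : ℝ) : EReal) ∈ Set.Iic z
    · have hlt : cqrScore qlo qhi (ca i) < -t := EReal.coe_lt_coe_iff.1 (lt_of_le_of_lt hi hzt)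
      have hmem : ca i ∈ {p | cqrScore qlo qhi p < -t} := hlt
      rw [Set.indicator_of_mem hi, Set.indicator_of_mem hmem]
      simp [calWeight, div_eq_mul_inv]
    · simp [Set.indicator_of_notMem hi]
  have := ENNReal.mul_le_of_le_div (le_trans hz hle)
  exact le_trans (by gcongr; exact le_self_add) this

lemma mem_cqrInterval_of_mem_Icc (h : ((-t : ℝ) : EReal) ≤ cqrCorrection α qlo qhi w ca x)
    {lo hi e y : ℝ} (hlo : |qlo x - lo| ≤ e) (hhi : |qhi x - hi| ≤ e)
    (hy : y ∈ Set.Icc (lo + (t + e)) (hi - (t + e))) : y ∈ cqrInterval α qlo qhi w ca x := by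
  have h1 := abs_le.1 hlo
  have h2 := abs_le.1 hhi
  refine ⟨(EReal.sub_le_sub le_rfl h).trans ?_, le_trans ?_ (add_le_add le_rfl h)⟩
  · rw [← EReal.coe_sub, EReal.coe_le_coe_iff]
    linarith [hy.1]
  · rw [← EReal.coe_add, EReal.coe_le_coe_iff]
    linarith [hy.2]

lemma cqrScore_lt_subset {lo hi e : ℝ} (hlo : |qlo x - lo| ≤ e) (hhi : |qhi x - hi| ≤ e) :
    {y | cqrScore qlo qhi (x, y) < -t} ⊆ Set.Ioo (lo + (t - e)) (hi - (t - e)) := by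
  intro y hy
  have h1 := abs_le.1 hlo
  have h2 := abs_le.1 hhi
  obtain ⟨h3, h4⟩ := max_lt_iff.1
    (show max (qlo x - y) (y - qhi x) < -t from hy)
  constructor <;> linarith

end Correction

/-! ### Coverage at a fixed training fold and test point. -/

namespace CQRProblem

variable {𝒳 : Type u} [MeasurableSpace 𝒳] (S : CQRProblem 𝒳)

instance (m : ℕ) : IsProbabilityMeasure (S.sampleLaw m) := by
  unfold sampleLaw; infer_instance

lemma measurable_wHat (N : ℕ) : Measurable (Function.uncurry (S.wHat N)) :=
  (S.measurable_wRaw N).div ((S.measurable_wRaw N).lintegral_prod_right'.comp measurable_fst)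

lemma measurable_H (N : ℕ) : Measurable (Function.uncurry (S.H N)) := by
  have hlo : Measurable fun p : Sample 𝒳 N × 𝒳 => condQuantile S.PYX S.αlo p.2 :=
    (measurable_condQuantile S.PYX S.αlo_mem).comp measurable_snd
  have hhi : Measurable fun p : Sample 𝒳 N × 𝒳 => condQuantile S.PYX S.αhi p.2 :=
    (measurable_condQuantile S.PYX S.αhi_mem).comp measurable_snd
  have h1 : Measurable fun p : Sample 𝒳 N × 𝒳 =>
      |S.qLo N p.1 p.2 - condQuantile S.PYX S.αlo p.2| :=
    measurable_norm.comp ((S.measurable_qLo N).sub hlo)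
  have h2 : Measurable fun p : Sample 𝒳 N × 𝒳 =>
      |S.qHi N p.1 p.2 - condQuantile S.PYX S.αhi p.2| :=
    measurable_norm.comp ((S.measurable_qHi N).sub hhi)
  exact h1.max h2

lemma lintegral_wHat {N : ℕ} {tr : Sample 𝒳 N}
    (h : (∫⁻ x, S.wRaw N tr x ∂S.PX) ≠ 0 ∧ (∫⁻ x, S.wRaw N tr x ∂S.PX) ≠ ∞) :
    ∫⁻ x, S.wHat N tr x ∂S.PX = 1 := by
  have hm : Measurable (S.wRaw N tr) := (S.measurable_wRaw N).of_uncurry_left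
  simp only [wHat, div_eq_mul_inv]
  rw [lintegral_mul_const _ hm, ENNReal.mul_inv_cancel h.1 h.2]

/-- `E[ŵ_N(X) H_N(X)^k | Z_tr]`. -/
noncomputable def condWHatErr (N : ℕ) (k : ℝ) (tr : Sample 𝒳 N) : ℝ≥0∞ :=
  ∫⁻ x, S.wHat N tr x * ENNReal.ofReal (S.H N tr x) ^ k ∂S.PX

/-- `E[ŵ_N(X)^s | Z_tr]`. -/
noncomputable def condWHatMoment (N : ℕ) (s : ℝ) (tr : Sample 𝒳 N) : ℝ≥0∞ :=
  ∫⁻ x, S.wHat N tr x ^ s ∂S.PX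

/-- A bound, up to a constant, for the conditional probability given the training fold that the
correction is less than `-t`. -/
noncomputable def calBound (N n : ℕ) (k d t : ℝ) (tr : Sample 𝒳 N) : ℝ≥0∞ :=
  ENNReal.ofReal (t ^ (-(k + 1))) * S.condWHatErr N k tr +
    ENNReal.ofReal ((n : ℝ) ^ (-d) * t ^ (-(1 + d))) * S.condWHatMoment N (1 + d) tr

/-- Regularity of the conditional law of `Y` given `X = x`: the quantiles are attained exactly,
and there is a density with values in `[b₁, b₂]` around them. -/
structure RegularAt (r b₁ b₂ : ℝ) (x : 𝒳) : Prop where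
  density : HasDensityBetweenOn (S.PYX x)
    (Set.Icc (condQuantile S.PYX S.αlo x - r) (condQuantile S.PYX S.αlo x + r) ∪
      Set.Icc (condQuantile S.PYX S.αhi x - r) (condQuantile S.PYX S.αhi x + r)) b₁ b₂
  lo : (S.PYX x).real (Set.Iic (condQuantile S.PYX S.αlo x)) = S.αlo
  hi : (S.PYX x).real (Set.Iic (condQuantile S.PYX S.αhi x)) = S.αhi

variable {S} in
lemma Assumptions.regularAt {r b₁ b₂ δ M k ℓ : ℝ} (h : S.Assumptions r b₁ b₂ δ M k ℓ)
    (hr : 0 ≤ r) : ∀ᵐ x ∂S.PX, S.RegularAt r b₁ b₂ x := by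
  filter_upwards [h.density] with x hx
  exact ⟨hx,
    measureReal_Iic_condQuantile _ S.αlo_mem (hx.measure_singleton (Or.inl (by simp [hr]))),
    measureReal_Iic_condQuantile _ S.αhi_mem (hx.measure_singleton (Or.inr (by simp [hr])))⟩

/-- The calibration folds for which the weighted vote for scores below `-t` reaches the share
`1 - α`. -/
def voteSet {N : ℕ} (n : ℕ) (t : ℝ) (tr : Sample 𝒳 N) : Set (Sample 𝒳 n) :=
  {ca | ENNReal.ofReal (1 - S.α) * ∑ i, S.wHat N tr (ca i).1 ≤
    ∑ i, {p | cqrScore (S.qLo N tr) (S.qHi N tr) p < -t}.indicator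
      (fun p => S.wHat N tr p.1) (ca i)}

/-- The constant in the bound for the probability of `voteSet`. -/
noncomputable def voteConst (r b₁ k : ℝ) : ℝ :=
  4 * r + 8 * (1 + b₁ * r / 2) * 2 ^ k / b₁ + (1 + 16 / b₁ ^ 2)

/-- This is `pi_weighted_vote_le` with exceptional set `{H > t/2}`, deficit `γ = b₁ t/2` and
truncation level `τ = n t`. -/
lemma sampleLaw_voteSet_le {r b₁ b₂ k d t : ℝ} (hb₁ : 0 < b₁) (hb₂ : 0 ≤ b₂)
    (hk : 0 ≤ k) (hd : 0 ≤ d) (hd1 : d ≤ 1) (ht : 0 < t) (htr : t ≤ r)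
    (hreg : ∀ᵐ x ∂S.PX, S.RegularAt r b₁ b₂ x) (hlev : S.αhi - S.αlo = 1 - S.α)
    (hgap : b₂ * t < 1 - S.α) {N n : ℕ} (hn : 0 < n) {tr : Sample 𝒳 N}
    (hnorm : ∫⁻ x, S.wHat N tr x ∂S.PX = 1) :
    S.sampleLaw n (S.voteSet n t tr) ≤
      ENNReal.ofReal (voteConst r b₁ k) * S.calBound N n k d t tr := by
  have hr : 0 < r := ht.trans_le htr
  have hn' : (0 : ℝ) < n := by exact_mod_cast hn
  -- The summands of `voteConst` serve, in order, the truncation bias, the mass of the exceptional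
  -- set, and the sum of the tail and Chebyshev terms.
  have hC1 : 4 * r ≤ voteConst r b₁ k := by
    have : 0 ≤ 8 * (1 + b₁ * r / 2) * 2 ^ k / b₁ := by positivity
    have : 0 ≤ 16 / b₁ ^ 2 := by positivity
    simp only [voteConst]; linarith
  have hC2 : 8 * (1 + b₁ * r / 2) * 2 ^ k / b₁ ≤ voteConst r b₁ k := by
    have : 0 ≤ 16 / b₁ ^ 2 := by positivity
    simp only [voteConst]; linarith
  have hC3 : 1 + 16 / b₁ ^ 2 ≤ voteConst r b₁ k := by
    have : 0 ≤ 8 * (1 + b₁ * r / 2) * 2 ^ k / b₁ := by positivity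
    simp only [voteConst]; linarith
  have hC0 : 0 < voteConst r b₁ k := by linarith
  -- A bound of at least `1` is trivial. Otherwise its smallness makes the moments finite and
  -- supplies the two smallness hypotheses of `pi_weighted_vote_le`.
  rcases le_or_gt 1 (ENNReal.ofReal (voteConst r b₁ k) * S.calBound N n k d t tr) with hbig | hsmall
  · exact prob_le_one.trans hbig
  have hpe : 0 < t ^ (-(k + 1)) := by positivity
  have hpm : 0 < (n : ℝ) ^ (-d) * t ^ (-(1 + d)) := by positivity
  have hfin : S.calBound N n k d t tr ≠ ∞ := fun h => by
    rw [h, ENNReal.mul_top (by simpa using hC0)] at hsmall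
    simp at hsmall
  have hefin : S.condWHatErr N k tr ≠ ∞ := fun h => hfin (by
    rw [calBound, h, ENNReal.mul_top (by simpa using hpe), top_add])
  have hmfin : S.condWHatMoment N (1 + d) tr ≠ ∞ := fun h => hfin (by
    rw [calBound, h, ENNReal.mul_top (by simpa using hpm), add_top])
  obtain ⟨e, he0, he⟩ : ∃ e : ℝ, 0 ≤ e ∧ S.condWHatErr N k tr = ENNReal.ofReal e :=
    ⟨_, ENNReal.toReal_nonneg, (ENNReal.ofReal_toReal hefin).symm⟩
  obtain ⟨m, hm0, hm⟩ : ∃ m : ℝ, 0 ≤ m ∧ S.condWHatMoment N (1 + d) tr = ENNReal.ofReal m :=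
    ⟨_, ENNReal.toReal_nonneg, (ENNReal.ofReal_toReal hmfin).symm⟩
  have hU : ENNReal.ofReal (voteConst r b₁ k) * S.calBound N n k d t tr =
      ENNReal.ofReal (voteConst r b₁ k *
        (t ^ (-(k + 1)) * e + (n : ℝ) ^ (-d) * t ^ (-(1 + d)) * m)) := by
    rw [calBound, he, hm, ENNReal.ofReal_mul hC0.le, ENNReal.ofReal_add (by positivity)
      (by positivity), ← ENNReal.ofReal_mul hpe.le, ← ENNReal.ofReal_mul hpm.le]
  rw [hU] at hsmall ⊢
  rw [ENNReal.ofReal_lt_one] at hsmall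
  have hse : voteConst r b₁ k * (t ^ (-(k + 1)) * e) ≤ 1 := by
    have : 0 ≤ voteConst r b₁ k * ((n : ℝ) ^ (-d) * t ^ (-(1 + d)) * m) := by positivity
    linarith
  have hsm : voteConst r b₁ k * ((n : ℝ) ^ (-d) * t ^ (-(1 + d)) * m) ≤ 1 := by
    have : 0 ≤ voteConst r b₁ k * (t ^ (-(k + 1)) * e) := by positivity
    linarith
  have hwm : Measurable (S.wHat N tr) := (S.measurable_wHat N).of_uncurry_left
  have hHm : Measurable (S.H N tr) := (S.measurable_H N).of_uncurry_left
  have hqlo : Measurable (S.qLo N tr) := (S.measurable_qLo N).of_uncurry_left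
  have hqhi : Measurable (S.qHi N tr) := (S.measurable_qHi N).of_uncurry_left
  have hA : MeasurableSet {p | cqrScore (S.qLo N tr) (S.qHi N tr) p < -t} := by
    refine measurableSet_lt ?_ measurable_const
    exact ((hqlo.comp measurable_fst).sub measurable_snd).max
      (measurable_snd.sub (hqhi.comp measurable_fst))
  have hB : MeasurableSet {x | t / 2 < S.H N tr x} := measurableSet_lt measurable_const hHm
  -- Markov's inequality under the weighted measure: `1 ≤ (2 H / t)^k` on this set.
  have heB : ∫⁻ x in {x | t / 2 < S.H N tr x}, S.wHat N tr x ∂S.PX ≤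
      ENNReal.ofReal ((t / 2) ^ (-k) * e) := by
    rw [ENNReal.ofReal_mul (by positivity), ← he, condWHatErr,
      ← lintegral_const_mul _ (by fun_prop)]
    refine (setLIntegral_mono' hB fun x hx => ?_).trans (setLIntegral_le_lintegral _ _)
    have hH0 : 0 < S.H N tr x := lt_trans (by positivity) hx
    calc S.wHat N tr x = S.wHat N tr x * ENNReal.ofReal 1 := by simp
      _ ≤ S.wHat N tr x * ENNReal.ofReal ((t / 2) ^ (-k) * S.H N tr x ^ k) := by
          gcongr
          rw [Real.rpow_neg (by positivity), ← div_eq_inv_mul,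
            ← Real.div_rpow hH0.le (by positivity)]
          exact Real.one_le_rpow ((one_le_div (by positivity)).2 (le_of_lt hx)) hk
      _ = _ := by
          rw [ENNReal.ofReal_mul (by positivity), ENNReal.ofReal_rpow_of_pos hH0]
          ring
  have hAB : ∀ᵐ x ∂S.PX, x ∉ {x | t / 2 < S.H N tr x} →
      (S.PYX x).real (Prod.mk x ⁻¹' {p | cqrScore (S.qLo N tr) (S.qHi N tr) p < -t}) ≤
        (1 - S.α) - b₁ * (t / 2) := by
    filter_upwards [hreg] with x hx hxB
    have hH : S.H N tr x ≤ t / 2 := not_lt.1 hxB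
    have hsub := cqrScore_lt_subset (t := t) ((le_max_left _ _).trans hH)
      ((le_max_right _ _).trans hH)
    rw [show t - t / 2 = t / 2 by ring] at hsub
    rw [← hlev]
    refine (measureReal_mono hsub).trans (measureReal_band_le hb₁.le hb₂ hx.density hx.lo hx.hi
      (by positivity) (by linarith) ?_)
    rw [hlev]
    nlinarith
  have hcard := S.α_mem
  have hmain := pi_weighted_vote_le S.PX S.PYX hwm hnorm hA hB (c := 1 - S.α) (γ := b₁ * (t / 2))
    (d := d) (m := m) (e := (t / 2) ^ (-k) * e) (τ := n * t) (by linarith [hcard.2])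
    (by linarith [hcard.1]) (by positivity) hd hd1 hm0 (by positivity) (by positivity) hAB hm.le heB
    (by
      calc ((n : ℝ) * t) ^ (-d) * m = t * ((n : ℝ) ^ (-d) * t ^ (-(1 + d)) * m) := by
            rw [Real.mul_rpow hn'.le ht.le, show -d = 1 + -(1 + d) by ring, Real.rpow_add ht,
              Real.rpow_one]
            ring
        _ ≤ r * (1 / (4 * r)) := by
            gcongr
            rw [le_div_iff₀ (by positivity), mul_comm]
            exact le_trans (by gcongr) hsm
        _ = 1 / 4 := by field_simp)
    (by
      have h1 : (t / 2) ^ (-k) * e = 2 ^ k * t * (t ^ (-(k + 1)) * e) := by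
        rw [Real.div_rpow ht.le (by norm_num), show -k = 1 + -(k + 1) by ring, Real.rpow_add ht,
          Real.rpow_one, show 1 + -(k + 1) = -k by ring, Real.rpow_neg (by norm_num : (0:ℝ) ≤ 2)]
        field_simp
      have h2 : 8 * (1 + b₁ * r / 2) * 2 ^ k / b₁ * (t ^ (-(k + 1)) * e) ≤ 1 :=
        le_trans (by gcongr) hse
      have h3 : (1 + b₁ * r / 2) * 2 ^ k * (t ^ (-(k + 1)) * e) ≤ b₁ / 8 := by
        rw [div_mul_eq_mul_div, div_le_one hb₁] at h2
        linarith
      calc (1 + b₁ * (t / 2)) * ((t / 2) ^ (-k) * e)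
          ≤ (1 + b₁ * r / 2) * (2 ^ k * t * (t ^ (-(k + 1)) * e)) := by
            rw [h1, show b₁ * (t / 2) = b₁ * t / 2 by ring]
            gcongr
        _ = t * ((1 + b₁ * r / 2) * 2 ^ k * (t ^ (-(k + 1)) * e)) := by ring
        _ ≤ t * (b₁ / 8) := by gcongr
        _ = _ := by ring) hn
  refine hmain.trans (ENNReal.ofReal_le_ofReal ?_)
  have h1 : (n : ℝ) * ((n * t) ^ (-(1 + d)) * m) = (n : ℝ) ^ (-d) * t ^ (-(1 + d)) * m := by
    rw [Real.mul_rpow hn'.le ht.le, show -d = 1 + -(1 + d) by ring, Real.rpow_add hn',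
      Real.rpow_one]
    ring
  -- The choice `τ = n t` gives the variance term the same powers of `n` and `t` as the tail term
  -- `h1`; the factor `16 / b₁ ^ 2` comes from `γ / 2 = b₁ t / 4`.
  have h2 : ((n : ℝ) * t) ^ (1 - d) * m / (n * (b₁ * (t / 2) / 2) ^ 2) =
      16 / b₁ ^ 2 * ((n : ℝ) ^ (-d) * t ^ (-(1 + d)) * m) := by
    rw [Real.mul_rpow hn'.le ht.le, show 1 - d = 1 + -d by ring, Real.rpow_add hn',
      Real.rpow_one, show 1 + -d = 2 + -(1 + d) by ring, Real.rpow_add ht, Real.rpow_two]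
    field_simp
    norm_num
  rw [h1, h2]
  calc _ = (1 + 16 / b₁ ^ 2) * ((n : ℝ) ^ (-d) * t ^ (-(1 + d)) * m) := by ring
    _ ≤ voteConst r b₁ k * ((n : ℝ) ^ (-d) * t ^ (-(1 + d)) * m) := by gcongr
    _ ≤ _ := by
        gcongr
        have : 0 ≤ t ^ (-(k + 1)) * e := by positivity
        linarith

/-- The constant in the pointwise coverage bound. -/
noncomputable def covConst (r b₁ b₂ k : ℝ) : ℝ := voteConst r b₁ k + 2 * b₂ + 1 / r

/-- Coverage is at least the mass of the band shrunk by `t + H`, minus the probability of the vote.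
The cap at `1` on the `H` term lets it be averaged later even when `H` has only a small moment `ℓ <
1`. -/
lemma ofReal_le_coverageGivenXTrain_add {r b₁ b₂ k d t : ℝ} (hr : 0 < r) (hb₁ : 0 < b₁)
    (hb₂ : 0 < b₂) (hk : 0 ≤ k) (hd : 0 ≤ d) (hd1 : d ≤ 1) (ht : 0 < t)
    (hreg : ∀ᵐ x ∂S.PX, S.RegularAt r b₁ b₂ x) (hlev : S.αhi - S.αlo = 1 - S.α)
    {N n : ℕ} (hn : 0 < n) {tr : Sample 𝒳 N} (hnorm : ∫⁻ x, S.wHat N tr x ∂S.PX = 1)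
    {x : 𝒳} (hx : S.RegularAt r b₁ b₂ x) :
    ENNReal.ofReal (1 - S.α) ≤ S.coverageGivenXTrain n tr x +
      (ENNReal.ofReal (covConst r b₁ b₂ k) * (ENNReal.ofReal t + S.calBound N n k d t tr) +
        min 1 (ENNReal.ofReal (covConst r b₁ b₂ k) * ENNReal.ofReal (S.H N tr x))) := by
  set C := covConst r b₁ b₂ k with hC
  have hV : 0 ≤ voteConst r b₁ k := by unfold voteConst; positivity
  have hr' : 0 < 1 / r := by positivity
  have hCV : voteConst r b₁ k ≤ C := by simp only [hC, covConst]; linarith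
  have hCb : 2 * b₂ ≤ C := by simp only [hC, covConst]; linarith
  have hCr : 1 / r ≤ C := by simp only [hC, covConst]; linarith
  have hC0 : 0 ≤ C := hr'.le.trans hCr
  have hα := S.α_mem
  set h := S.H N tr x with hh
  have hh0 : 0 ≤ h := (abs_nonneg _).trans (le_max_left _ _)
  have hone : ENNReal.ofReal (1 - S.α) ≤ 1 := by
    rw [← ENNReal.ofReal_one]; exact ENNReal.ofReal_le_ofReal (by linarith [hα.1])
  have hCt : 1 - S.α ≤ C * t → ENNReal.ofReal (1 - S.α) ≤ S.coverageGivenXTrain n tr x +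
      (ENNReal.ofReal C * (ENNReal.ofReal t + S.calBound N n k d t tr) +
        min 1 (ENNReal.ofReal C * ENNReal.ofReal h)) := fun hle => by
    refine le_trans ?_ (le_add_self.trans' le_self_add)
    rw [mul_add, ← ENNReal.ofReal_mul hC0]
    exact (ENNReal.ofReal_le_ofReal hle).trans le_self_add
  rw [← ENNReal.ofReal_mul hC0]
  rw [← ENNReal.ofReal_mul hC0] at hCt
  -- The cases `C * h ≥ 1`, `1 - α ≤ b₂ * t` and `r < t + h` are trivial: the error term alone
  -- exceeds `1 - α`. The summands `2 * b₂` and `1 / r` of `covConst` provide for the last two.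
  rcases le_or_gt 1 (C * h) with h1 | h1
  · rw [min_eq_left (by rwa [ENNReal.one_le_ofReal])]
    exact hone.trans (le_add_self.trans le_add_self)
  by_cases hcase1 : 1 - S.α ≤ b₂ * t
  · exact hCt (hcase1.trans (by nlinarith))
  push Not at hcase1
  rw [min_eq_right (by rw [← ENNReal.ofReal_one]; exact ENNReal.ofReal_le_ofReal h1.le)]
  by_cases hcase2 : r < t + h
  · have hle : 1 - S.α ≤ C * t + C * h := by
      have : 1 ≤ C * (t + h) := by
        calc (1 : ℝ) = 1 / r * r := by field_simp
          _ ≤ C * (t + h) := by gcongr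
      linarith [hα.1]
    calc ENNReal.ofReal (1 - S.α) ≤ ENNReal.ofReal (C * t) + ENNReal.ofReal (C * h) := by
          rw [← ENNReal.ofReal_add (by positivity) (by positivity)]
          exact ENNReal.ofReal_le_ofReal hle
      _ ≤ _ := by
          refine le_trans ?_ le_add_self
          gcongr
          rw [mul_add, ← ENNReal.ofReal_mul hC0]
          exact le_self_add
  push Not at hcase2
  have hvote := S.sampleLaw_voteSet_le hb₁ hb₂.le hk hd hd1 ht (by linarith) hreg hlev hcase1 hn
    hnorm
  set I := Set.Icc (condQuantile S.PYX S.αlo x + (t + h)) (condQuantile S.PYX S.αhi x - (t + h))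
  have hI := le_measureReal_band hb₂.le hx.density hx.lo hx.hi (s := t + h) (by positivity) hcase2
  rw [hlev] at hI
  -- The vote depends only on the calibration fold and `I` only on `Y`, so the covering event
  -- contains a rectangle.
  have hcov : S.sampleLaw n (S.voteSet n t tr)ᶜ * S.PYX x I ≤ S.coverageGivenXTrain n tr x := by
    rw [← Measure.prod_prod]
    refine measure_mono fun ω hω => ?_
    have hη : ((-t : ℝ) : EReal) ≤
        cqrCorrection S.α (S.qLo N tr) (S.qHi N tr) (S.wHat N tr) ω.1 x := by
      by_contra! hlt
      exact hω.1 (vote_of_cqrCorrection_lt hlt)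
    exact mem_cqrInterval_of_mem_Icc hη (le_max_left _ _) (le_max_right _ _) hω.2
  have hsplit : S.PYX x I ≤ S.sampleLaw n (S.voteSet n t tr)ᶜ * S.PYX x I +
      S.sampleLaw n (S.voteSet n t tr) := by
    have h1 : (1 : ℝ≥0∞) ≤ S.sampleLaw n (S.voteSet n t tr)ᶜ + S.sampleLaw n (S.voteSet n t tr) := by
      rw [← measure_univ (μ := S.sampleLaw n), ← Set.compl_union_self (S.voteSet n t tr)]
      exact measure_union_le _ _
    calc S.PYX x I = 1 * S.PYX x I := (one_mul _).symm
      _ ≤ (S.sampleLaw n (S.voteSet n t tr)ᶜ + S.sampleLaw n (S.voteSet n t tr)) * S.PYX x I := by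
          gcongr
      _ ≤ _ := by
          rw [add_mul]
          gcongr
          exact mul_le_of_le_one_right' prob_le_one
  calc ENNReal.ofReal (1 - S.α)
      ≤ ENNReal.ofReal ((S.PYX x).real I + (C * t + C * h)) := by
        refine ENNReal.ofReal_le_ofReal ?_
        nlinarith
    _ = S.PYX x I + (ENNReal.ofReal (C * t) + ENNReal.ofReal (C * h)) := by
        rw [ENNReal.ofReal_add (by positivity) (by positivity),
          ENNReal.ofReal_add (by positivity) (by positivity), ofReal_measureReal]
    _ ≤ (S.coverageGivenXTrain n tr x + ENNReal.ofReal C * S.calBound N n k d t tr) +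
        (ENNReal.ofReal (C * t) + ENNReal.ofReal (C * h)) := by
        gcongr
        refine hsplit.trans (add_le_add hcov (hvote.trans ?_))
        gcongr
    _ = _ := by
        rw [mul_add, ← ENNReal.ofReal_mul hC0]
        ring

end CQRProblem

/-! ### Markov bounds, splitting at a level, and product measures. -/

section Auxiliary

/-- With the strict inequality, Markov's bound survives when the integral is `0` or `∞`. -/
lemma measure_inv_mul_lintegral_lt_le {Ω : Type*} [MeasurableSpace Ω] (μ : Measure Ω)
    {f : Ω → ℝ≥0∞} (hf : Measurable f) {ε : ℝ≥0∞} (h0 : ε ≠ 0) (ht : ε ≠ ∞) :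
    μ {x | ε⁻¹ * ∫⁻ y, f y ∂μ < f x} ≤ ε := by
  set I := ∫⁻ y, f y ∂μ with hI
  have hε : ε⁻¹ ≠ 0 := ENNReal.inv_ne_zero.2 ht
  rcases eq_or_ne I ∞ with h | h
  · simp [h, ENNReal.mul_top hε]
  rcases eq_or_ne I 0 with h' | h'
  · have hz : f =ᵐ[μ] 0 := (lintegral_eq_zero_iff hf).1 (hI.symm.trans h')
    have : μ {x | ε⁻¹ * I < f x} = 0 := by
      rw [measure_eq_zero_iff_ae_notMem]
      filter_upwards [hz] with x hx
      simp [hx]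
    simp [this]
  · calc μ {x | ε⁻¹ * I < f x} ≤ μ {x | ε⁻¹ * I ≤ f x} :=
          measure_mono fun x (hx : ε⁻¹ * I < f x) => hx.le
      _ ≤ I / (ε⁻¹ * I) := meas_ge_le_lintegral_div hf.aemeasurable (mul_ne_zero hε h')
          (ENNReal.mul_ne_top (ENNReal.inv_ne_top.2 h0) h)
      _ = ε := by
          rw [ENNReal.div_eq_inv_mul, ENNReal.mul_inv (Or.inl hε)
            (Or.inl (ENNReal.inv_ne_top.2 h0)), inv_inv, mul_assoc, ENNReal.inv_mul_cancel h' h,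
            mul_one]

/-- Only subadditivity is used, so the good event `G`, later a superlevel set of coverage, need not
be measurable. -/
lemma prob_le_of_compl_subset {Ω : Type*} [MeasurableSpace Ω] {μ : Measure Ω}
    [IsProbabilityMeasure μ] {β : ℝ} (hβ : 0 ≤ β) {E B G : Set Ω} (hE : ∀ᵐ x ∂μ, x ∈ E)
    (hB : μ B ≤ ENNReal.ofReal β) (h : ∀ x ∈ E, x ∉ B → x ∈ G) : ENNReal.ofReal (1 - β) ≤ μ G := by
  have hGB : (1 : ℝ≥0∞) ≤ μ G + μ B := by
    have h1 : μ (E ∩ (G ∪ B)) = μ E :=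
      congrArg μ (Set.inter_eq_left.2 fun x hx => by
        by_cases hxB : x ∈ B
        · exact Or.inr hxB
        · exact Or.inl (h x hx hxB))
    have h2 : μ E = 1 := by
      rw [← measure_univ (μ := μ)]
      exact measure_congr (eventuallyEq_univ.2 hE)
    rw [← h2, ← h1]
    exact (measure_mono Set.inter_subset_right).trans (measure_union_le _ _)
  rw [ENNReal.ofReal_sub _ hβ, ENNReal.ofReal_one, tsub_le_iff_right]
  exact hGB.trans (by gcongr)

lemma one_le_rpow_neg_mul_rpow {s h : ℝ≥0∞} {p : ℝ} (hp : 0 ≤ p) (hsh : s < h) (hh : h ≠ ∞) :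
    1 ≤ s ^ (-p) * h ^ p := by
  have h0 : h ≠ 0 := (pos_of_gt hsh).ne'
  calc (1 : ℝ≥0∞) = h ^ (-p) * h ^ p := by rw [← ENNReal.rpow_add _ _ h0 hh]; simp
    _ ≤ _ := by
        gcongr ?_ * _
        rw [ENNReal.rpow_neg, ENNReal.rpow_neg]
        gcongr

/-- Below the level `s` the linear bound is used; above it the cap `1` is at most `(h / s)^p`. -/
lemma min_one_mul_le {c s h : ℝ≥0∞} {p : ℝ} (hp : 0 ≤ p) (hh : h ≠ ∞) :
    min 1 (c * h) ≤ c * s + s ^ (-p) * h ^ p := by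
  rcases le_or_gt h s with hsh | hsh
  · exact (min_le_right _ _).trans (le_add_right (by gcongr))
  · exact (min_le_left _ _).trans (le_add_left (one_le_rpow_neg_mul_rpow hp hsh hh))

lemma le_add_rpow_mul_rpow {s h : ℝ≥0∞} {p : ℝ} (hp : 1 ≤ p) (hh : h ≠ ∞) :
    h ≤ s + s ^ (1 - p) * h ^ p := by
  rcases le_or_gt h s with hsh | hsh
  · exact le_add_right hsh
  · refine le_add_left ?_
    have h0 : h ≠ 0 := (pos_of_gt hsh).ne'
    calc h = 1 * h := (one_mul _).symm
      _ ≤ s ^ (-(p - 1)) * h ^ (p - 1) * h := by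
          gcongr
          exact one_le_rpow_neg_mul_rpow (by linarith) hsh hh
      _ = s ^ (1 - p) * h ^ p := by
          rw [mul_assoc, neg_sub]
          congr 1
          nth_rewrite 2 [← ENNReal.rpow_one h]
          rw [← ENNReal.rpow_add _ _ h0 hh]
          simp

lemma min_one_le_rpow {a : ℝ≥0∞} {p : ℝ} (hp : 0 ≤ p) (hp1 : p ≤ 1) : min 1 a ≤ a ^ p := by
  rcases le_or_gt a 1 with h | h
  · refine (min_le_right _ _).trans ?_
    simpa using ENNReal.rpow_le_rpow_of_exponent_ge h hp1
  · exact (min_le_left _ _).trans (by simpa using ENNReal.rpow_le_rpow h.le hp)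

/-- Equality can fail at `s = ∞` when `p < 0`, where the product is `0 * ∞ = 0`. -/
lemma rpow_mul_rpow_le {s : ℝ≥0∞} {p q : ℝ} (hq : 0 < q) (hpq : p + q = 1) : s ^ p * s ^ q ≤ s := by
  rcases eq_or_ne s 0 with rfl | h0
  · simp [ENNReal.zero_rpow_of_pos hq]
  rcases eq_or_ne s ∞ with rfl | ht
  · simp
  rw [← ENNReal.rpow_add _ _ h0 ht, hpq, ENNReal.rpow_one]

/-- A measurable hull gives this half of Fubini for arbitrary sets. It is the direction needed for
lower bounds on coverage, and it avoids proving the covering event measurable. -/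
lemma lintegral_measure_prodMk_le {Ω Ω' : Type*} [MeasurableSpace Ω] [MeasurableSpace Ω']
    (μ : Measure Ω) (ν : Measure Ω') [SFinite ν] (s : Set (Ω × Ω')) :
    ∫⁻ x, ν (Prod.mk x ⁻¹' s) ∂μ ≤ μ.prod ν s := by
  rw [← measure_toMeasurable s, Measure.prod_apply (measurableSet_toMeasurable _ _)]
  exact lintegral_mono fun x => measure_mono (Set.preimage_mono (subset_toMeasurable _ _))

lemma prod_compProd_apply {Ω 𝒳 𝒴 : Type*} [MeasurableSpace Ω] [MeasurableSpace 𝒳]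
    [MeasurableSpace 𝒴] (μ : Measure Ω) [SFinite μ] (Q : Measure 𝒳) [SFinite Q] (κ : Kernel 𝒳 𝒴)
    [IsSFiniteKernel κ] {T : Set (Ω × 𝒳 × 𝒴)} (hT : MeasurableSet T) :
    μ.prod (Q ⊗ₘ κ) T = ∫⁻ x, μ.prod (κ x) {p | (p.1, x, p.2) ∈ T} ∂Q := by
  have hTx : ∀ x, MeasurableSet {p : Ω × 𝒴 | (p.1, x, p.2) ∈ T} := fun x =>
    (measurable_fst.prodMk (measurable_const.prodMk measurable_snd)) hT
  have hm : Measurable fun p : Ω × 𝒳 => κ p.2 {y | (p.1, p.2, y) ∈ T} := by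
    have hT' : MeasurableSet {q : (Ω × 𝒳) × 𝒴 | (q.1.1, q.1.2, q.2) ∈ T} :=
      ((measurable_fst.comp measurable_fst).prodMk
        ((measurable_snd.comp measurable_fst).prodMk measurable_snd)) hT
    exact Kernel.measurable_kernel_prodMk_left (κ := Kernel.prodMkLeft Ω κ) hT'
  rw [Measure.prod_apply hT]
  have h1 : ∀ ω, (Q ⊗ₘ κ) (Prod.mk ω ⁻¹' T) = ∫⁻ x, κ x {y | (ω, x, y) ∈ T} ∂Q := fun ω => by
    rw [Measure.compProd_apply (measurable_prodMk_left hT)]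
    rfl
  have h2 : ∀ x, μ.prod (κ x) {p | (p.1, x, p.2) ∈ T} = ∫⁻ ω, κ x {y | (ω, x, y) ∈ T} ∂μ :=
    fun x => by
      rw [Measure.prod_apply (hTx x)]
      rfl
  simp only [h1, h2]
  exact lintegral_lintegral_swap hm.aemeasurable

end Auxiliary

/-- The logarithmic factor is at least `1/2`, because `log 2 > 1/2` and its exponent lies in `[0,
1]`. -/
lemma rpow_neg_le_two_mul_calRate (δ : ℝ) (hδ : 0 < δ) {n : ℕ} (hn : 2 ≤ n) :
    ENNReal.ofReal ((n : ℝ) ^ (-(min δ 1 / (2 + min δ 1)))) ≤ 2 * calRate δ n := by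
  have hn2 : (2 : ℝ) ≤ n := by exact_mod_cast hn
  have hd : 0 < min δ 1 := lt_min hδ one_pos
  set d := min δ 1
  have hp0 : 0 ≤ (1 + d) / (2 * (2 + d)) := by positivity
  have hp1 : (1 + d) / (2 * (2 + d)) ≤ 1 := by
    rw [div_le_one (by positivity)]
    linarith
  have hlog : (1 / 2 : ℝ) ≤ Real.log n ^ ((1 + d) / (2 * (2 + d))) := by
    have h1 : (1 / 2 : ℝ) ≤ Real.log n :=
      (by linarith [Real.log_two_gt_d9] : (1 / 2 : ℝ) ≤ Real.log 2).trans
        (Real.log_le_log (by norm_num) hn2)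
    calc (1 / 2 : ℝ) = (1 / 2 : ℝ) ^ (1 : ℝ) := (Real.rpow_one _).symm
      _ ≤ (1 / 2 : ℝ) ^ ((1 + d) / (2 * (2 + d))) :=
          Real.rpow_le_rpow_of_exponent_ge (by norm_num) (by norm_num) hp1
      _ ≤ _ := by gcongr
  rw [calRate, show (2 : ℝ≥0∞) = ENNReal.ofReal 2 by simp, ← ENNReal.ofReal_mul (by norm_num)]
  refine ENNReal.ofReal_le_ofReal ?_
  rw [Real.rpow_neg (by positivity), ← mul_div_assoc, ← one_div]
  gcongr
  linarith

/-! ### Averaging over the training fold and choice of the threshold. -/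

namespace CQRProblem

variable {𝒳 : Type u} [MeasurableSpace 𝒳] (S : CQRProblem 𝒳)

lemma measurable_condWHatErr (N : ℕ) (k : ℝ) : Measurable (S.condWHatErr N k) :=
  ((S.measurable_wHat N).mul
    ((S.measurable_H N).ennreal_ofReal.pow_const k)).lintegral_prod_right'

lemma measurable_condWHatMoment (N : ℕ) (s : ℝ) : Measurable (S.condWHatMoment N s) :=
  ((S.measurable_wHat N).pow_const s).lintegral_prod_right'

lemma measurable_calBound (N n : ℕ) (k d t : ℝ) : Measurable (S.calBound N n k d t) :=
  ((S.measurable_condWHatErr N k).const_mul _).add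
    ((S.measurable_condWHatMoment N (1 + d)).const_mul _)

lemma lintegral_condWHatErr (N : ℕ) (k : ℝ) :
    ∫⁻ tr, S.condWHatErr N k tr ∂S.sampleLaw N = S.wHatErr N k :=
  (lintegral_prod _ ((S.measurable_wHat N).mul
    ((S.measurable_H N).ennreal_ofReal.pow_const k)).aemeasurable).symm

lemma lintegral_condWHatMoment (N : ℕ) (s : ℝ) :
    ∫⁻ tr, S.condWHatMoment N s tr ∂S.sampleLaw N = S.wHatMoment N s :=
  (lintegral_prod _ ((S.measurable_wHat N).pow_const s).aemeasurable).symm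

lemma lintegral_H_rpow (hac : S.QX ≪ S.PX) (N : ℕ) (ℓ : ℝ) :
    ∫⁻ p, ENNReal.ofReal (S.H N p.1 p.2) ^ ℓ ∂(S.sampleLaw N).prod S.QX = S.wErr N ℓ := by
  have hH : Measurable fun p : Sample 𝒳 N × 𝒳 => ENNReal.ofReal (S.H N p.1 p.2) ^ ℓ :=
    (S.measurable_H N).ennreal_ofReal.pow_const ℓ
  have hw : Measurable fun p : Sample 𝒳 N × 𝒳 => S.w p.2 :=
    (Measure.measurable_rnDeriv _ _).comp measurable_snd
  have hwH : Measurable fun p : Sample 𝒳 N × 𝒳 =>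
      S.w p.2 * ENNReal.ofReal (S.H N p.1 p.2) ^ ℓ := hw.mul hH
  rw [wErr, lintegral_prod _ hH.aemeasurable, lintegral_prod _ hwH.aemeasurable]
  refine lintegral_congr fun tr => ?_
  exact (lintegral_rnDeriv_mul hac (hH.comp measurable_prodMk_left).aemeasurable).symm

/-- As the covering event is not known to be measurable, Fubini is applied to its measurable hull,
which has the same measure. -/
lemma lintegral_coverageGivenXTrain_le (N n : ℕ) :
    ∫⁻ p, S.coverageGivenXTrain n p.1 p.2 ∂(S.sampleLaw N).prod S.QX ≤ S.coverage N n := by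
  set T := toMeasurable ((S.sampleLaw N).prod ((S.sampleLaw n).prod (S.QX ⊗ₘ S.PYX)))
    {ω | ω.2.2.2 ∈ S.interval ω.1 ω.2.1 ω.2.2.1} with hTdef
  have hT : MeasurableSet T := measurableSet_toMeasurable _ _
  have hsub : {ω | ω.2.2.2 ∈ S.interval ω.1 ω.2.1 ω.2.2.1} ⊆ T := subset_toMeasurable _ _
  have hcov : S.coverage N n = ∫⁻ tr, ∫⁻ x, (S.sampleLaw n).prod (S.PYX x)
      {p | (tr, p.1, x, p.2) ∈ T} ∂S.QX ∂S.sampleLaw N := by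
    rw [coverage, ← measure_toMeasurable, Measure.prod_apply hT]
    exact lintegral_congr fun tr => prod_compProd_apply _ _ _ (measurable_prodMk_left hT)
  rw [hcov]
  refine (lintegral_prod_le _).trans (lintegral_mono fun tr => lintegral_mono fun x => ?_)
  exact measure_mono fun p hp => hsub (show (tr, p.1, x, p.2).2.2.2 ∈ S.interval _ _ _ from hp)

lemma lintegral_coverageGivenXTrain_le_coverageGivenX (N n : ℕ) (x : 𝒳) :
    ∫⁻ tr, S.coverageGivenXTrain n tr x ∂S.sampleLaw N ≤ S.coverageGivenX N n x :=
  lintegral_measure_prodMk_le (S.sampleLaw N) ((S.sampleLaw n).prod (S.PYX x)) _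

variable {S} {r b₁ b₂ δ M k ℓ : ℝ}

lemma Assumptions.wHatMoment_le (h : S.Assumptions r b₁ b₂ δ M k ℓ) (hδ : 0 < δ) (hM : 0 < M)
    (N : ℕ) : S.wHatMoment N (1 + min δ 1) ≤ ENNReal.ofReal (1 + M ^ (1 + δ)) := by
  have h1 : S.wHatMoment N (1 + δ) ≤ ENNReal.ofReal (M ^ (1 + δ)) := by
    have := ENNReal.rpow_le_rpow (h.moment N) (z := 1 + δ) (by linarith)
    rwa [← ENNReal.rpow_mul, one_div, inv_mul_cancel₀ (by linarith), ENNReal.rpow_one,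
      ENNReal.ofReal_rpow_of_pos hM] at this
  calc S.wHatMoment N (1 + min δ 1)
      ≤ ∫⁻ p, (1 + S.wHat N p.1 p.2 ^ (1 + δ)) ∂((S.sampleLaw N).prod S.PX) := by
        refine lintegral_mono fun p => ?_
        rcases le_or_gt (S.wHat N p.1 p.2) 1 with hw | hw
        · exact le_add_right (ENNReal.rpow_le_one hw (by positivity))
        · refine le_add_left (ENNReal.rpow_le_rpow_of_exponent_le hw.le ?_)
          gcongr
          exact min_le_left _ _
    _ = 1 + S.wHatMoment N (1 + δ) := by
        rw [lintegral_add_left measurable_const]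
        simp [wHatMoment]
    _ ≤ _ := by
        rw [ENNReal.ofReal_add zero_le_one (by positivity), ENNReal.ofReal_one]
        gcongr

/-- The two parts of `calBound` are balanced by the choice of the threshold `t`. -/
lemma Assumptions.exists_threshold (h : S.Assumptions r b₁ b₂ δ M k ℓ) (hδ : 0 < δ) (hM : 0 < M)
    (hk : 0 < k) {N n : ℕ} (hn : 2 ≤ n) (hA : S.wHatErr N k ≠ ∞) :
    ∃ t : ℝ, 0 < t ∧ ENNReal.ofReal t ≤ 2 * calRate δ n + S.wHatErr N k ^ (1 / (2 + k)) ∧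
      ∫⁻ tr, S.calBound N n k (min δ 1) t tr ∂S.sampleLaw N ≤
        ENNReal.ofReal (2 + M ^ (1 + δ)) * ENNReal.ofReal t := by
  have hn' : (0 : ℝ) < n := by exact_mod_cast (by omega : 0 < n)
  have hd : 0 < min δ 1 := lt_min hδ one_pos
  have hmom := h.wHatMoment_le hδ hM N
  have hrate := rpow_neg_le_two_mul_calRate δ hδ hn
  set d := min δ 1
  obtain ⟨a, ha0, ha⟩ : ∃ a : ℝ, 0 ≤ a ∧ S.wHatErr N k = ENNReal.ofReal a :=
    ⟨_, ENNReal.toReal_nonneg, (ENNReal.ofReal_toReal hA).symm⟩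
  -- Here `u` solves `n^(-d) u^(-(1+d)) = u` and, for `a > 0`, `v` below solves `v^(-(k+1)) a = v`;
  -- at `t = u + v` both coefficients are therefore at most `t`.
  set u := (n : ℝ) ^ (-(d / (2 + d))) with hu
  have hu0 : 0 < u := by positivity
  set v := a ^ (1 / (2 + k)) with hv
  have hv0 : 0 ≤ v := by positivity
  have ht : 0 < u + v := by positivity
  refine ⟨u + v, ht, ?_, ?_⟩
  · rw [ENNReal.ofReal_add hu0.le hv0, ha, ENNReal.ofReal_rpow_of_nonneg ha0 (by positivity)]
    gcongr
  set t := u + v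
  have hat : a ≤ t ^ (2 + k) := by
    calc a = v ^ (2 + k) := by
          rw [hv, ← Real.rpow_mul ha0, one_div, inv_mul_cancel₀ (by positivity), Real.rpow_one]
      _ ≤ t ^ (2 + k) := by
          gcongr
          exact le_add_of_nonneg_left hu0.le
  have hnt : (n : ℝ) ^ (-d) ≤ t ^ (2 + d) := by
    calc (n : ℝ) ^ (-d) = u ^ (2 + d) := by
          rw [hu, ← Real.rpow_mul hn'.le, neg_mul, div_mul_cancel₀ _ (by positivity)]
      _ ≤ t ^ (2 + d) := by
          gcongr
          exact le_add_of_nonneg_right hv0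
  have h1 : t ^ (-(k + 1)) * a ≤ t := by
    calc t ^ (-(k + 1)) * a ≤ t ^ (-(k + 1)) * t ^ (2 + k) := by gcongr
      _ = t := by
          rw [← Real.rpow_add ht, show -(k + 1) + (2 + k) = 1 by ring, Real.rpow_one]
  have h2 : (n : ℝ) ^ (-d) * t ^ (-(1 + d)) ≤ t := by
    calc (n : ℝ) ^ (-d) * t ^ (-(1 + d)) ≤ t ^ (2 + d) * t ^ (-(1 + d)) := by gcongr
      _ = t := by
          rw [← Real.rpow_add ht, show 2 + d + -(1 + d) = 1 by ring, Real.rpow_one]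
  calc ∫⁻ tr, S.calBound N n k d t tr ∂S.sampleLaw N
      = ENNReal.ofReal (t ^ (-(k + 1))) * S.wHatErr N k +
        ENNReal.ofReal ((n : ℝ) ^ (-d) * t ^ (-(1 + d))) * S.wHatMoment N (1 + d) := by
        simp only [calBound]
        rw [lintegral_add_left ((S.measurable_condWHatErr N k).const_mul _),
          lintegral_const_mul _ (S.measurable_condWHatErr N k),
          lintegral_const_mul _ (S.measurable_condWHatMoment N _), lintegral_condWHatErr,
          lintegral_condWHatMoment]
    _ ≤ ENNReal.ofReal t + ENNReal.ofReal t * ENNReal.ofReal (1 + M ^ (1 + δ)) := by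
        rw [ha, ← ENNReal.ofReal_mul (by positivity)]
        gcongr
    _ = _ := by
        rw [← ENNReal.ofReal_mul ht.le, ← ENNReal.ofReal_add ht.le (by positivity),
          ← ENNReal.ofReal_mul (by positivity)]
        congr 1
        ring

lemma Assumptions.ae_lintegral_wHat (h : S.Assumptions r b₁ b₂ δ M k ℓ) (N : ℕ) :
    ∀ᵐ tr ∂S.sampleLaw N, ∫⁻ x, S.wHat N tr x ∂S.PX = 1 := by
  filter_upwards [h.normalizable N] with tr htr using S.lintegral_wHat htr

end CQRProblem

/-! ### The three coverage guarantees. -/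

lemma tsub_mul_le_of_le_add {X p c₁ c₂ B s a D : ℝ≥0∞}
    (h : a ≠ ∞ → X ≤ p + (c₁ * (2 * s + a) + c₂ * D)) (hB : 2 * c₁ + c₂ + 1 ≤ B) :
    X - B * (s + a + D) ≤ p := by
  rcases eq_or_ne a ∞ with ha | ha
  · have hB0 : B ≠ 0 := fun h0 => by simp [h0] at hB
    simp [ha, ENNReal.mul_top hB0]
  rw [tsub_le_iff_right]
  refine (h ha).trans (add_le_add le_rfl ?_)
  calc c₁ * (2 * s + a) + c₂ * D ≤ (2 * c₁ + c₂) * s + (2 * c₁ + c₂) * a + (2 * c₁ + c₂) * D := by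
        rw [mul_add, ← mul_assoc, mul_comm c₁ 2]
        gcongr
        · exact le_self_add
        · refine le_add_right ?_
          rw [two_mul]
          exact le_self_add
        · exact le_add_self
    _ = (2 * c₁ + c₂) * (s + a + D) := by ring
    _ ≤ _ := by
        gcongr
        exact le_self_add.trans hB

namespace CQRProblem

variable {𝒳 : Type u} [MeasurableSpace 𝒳] {S : CQRProblem 𝒳} {r b₁ b₂ δ M k ℓ : ℝ}

lemma Assumptions.ofReal_le_coverage_add (h : S.Assumptions r b₁ b₂ δ M k ℓ) (hr : 0 < r)
    (hb₁ : 0 < b₁) (hb₂ : 0 < b₂) (hδ : 0 < δ) (hM : 0 < M) (hk : 0 < k) (hℓ : 0 < ℓ) {C K : ℝ≥0∞}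
    (hC : C = ENNReal.ofReal (covConst r b₁ b₂ k)) (hK : K = ENNReal.ofReal (2 + M ^ (1 + δ)))
    {N n : ℕ} (hn : 2 ≤ n) (hA : S.wHatErr N k ≠ ∞) :
    ENNReal.ofReal (1 - S.α) ≤ S.coverage N n +
      (C * (1 + K) * (2 * calRate δ n + S.wHatErr N k ^ (1 / (2 + k))) +
        (C + 1) * S.wErr N ℓ ^ (1 / (1 + ℓ))) := by
  obtain ⟨t, ht, htR, hint⟩ := h.exists_threshold hδ hM hk hn hA
  rw [← hK] at hint
  -- This level balances the two parts of `min_one_mul_le` after integration: `s^(-ℓ) * E[w H^ℓ]` is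
  -- at most `s`.
  set s := S.wErr N ℓ ^ (1 / (1 + ℓ)) with hs
  have hreg := h.regularAt hr.le
  have hae : ∀ᵐ p ∂(S.sampleLaw N).prod S.QX, ENNReal.ofReal (1 - S.α) ≤
      S.coverageGivenXTrain n p.1 p.2 + (C * (ENNReal.ofReal t + S.calBound N n k (min δ 1) t p.1) +
        (C * s + s ^ (-ℓ) * ENNReal.ofReal (S.H N p.1 p.2) ^ ℓ)) := by
    filter_upwards [Measure.quasiMeasurePreserving_fst.ae (h.ae_lintegral_wHat N),
      Measure.quasiMeasurePreserving_snd.ae (h.absCont.ae_le hreg)] with p hp1 hp2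
    refine (S.ofReal_le_coverageGivenXTrain_add hr hb₁ hb₂ hk.le (lt_min hδ one_pos).le
      (min_le_right δ 1) ht hreg h.levels (by omega : 0 < n) hp1 hp2).trans ?_
    rw [← hC]
    gcongr
    exact min_one_mul_le hℓ.le ENNReal.ofReal_ne_top
  have hm1 : Measurable fun p : Sample 𝒳 N × 𝒳 =>
      C * (ENNReal.ofReal t + S.calBound N n k (min δ 1) t p.1) :=
    (((S.measurable_calBound N n k (min δ 1) t).comp measurable_fst).const_add _).const_mul _
  have hm2 : Measurable fun p : Sample 𝒳 N × 𝒳 => ENNReal.ofReal (S.H N p.1 p.2) ^ ℓ :=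
    (S.measurable_H N).ennreal_ofReal.pow_const ℓ
  have hi1 : ∫⁻ p, C * (ENNReal.ofReal t + S.calBound N n k (min δ 1) t p.1)
      ∂(S.sampleLaw N).prod S.QX ≤
        C * (1 + K) * (2 * calRate δ n + S.wHatErr N k ^ (1 / (2 + k))) := by
    have hcal := S.measurable_calBound N n k (min δ 1) t
    rw [lintegral_prod _ hm1.aemeasurable]
    simp only [lintegral_const, measure_univ, mul_one]
    rw [lintegral_const_mul _ (hcal.const_add _), lintegral_add_right _ hcal, lintegral_const,
      measure_univ, mul_one, mul_assoc]
    gcongr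
    calc _ ≤ ENNReal.ofReal t + K * ENNReal.ofReal t := by gcongr
      _ = (1 + K) * ENNReal.ofReal t := by ring
      _ ≤ _ := by gcongr
  have hi2 : ∫⁻ p, (C * s + s ^ (-ℓ) * ENNReal.ofReal (S.H N p.1 p.2) ^ ℓ)
      ∂(S.sampleLaw N).prod S.QX ≤ (C + 1) * s := by
    rw [lintegral_add_left measurable_const, lintegral_const, measure_univ, mul_one,
      lintegral_const_mul _ hm2, S.lintegral_H_rpow h.absCont, add_mul, one_mul]
    gcongr
    have hD : S.wErr N ℓ = s ^ (1 + ℓ) := by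
      rw [hs, ← ENNReal.rpow_mul, one_div, inv_mul_cancel₀ (by positivity), ENNReal.rpow_one]
    rw [hD]
    exact rpow_mul_rpow_le (by positivity) (by ring)
  calc ENNReal.ofReal (1 - S.α)
      = ∫⁻ _, ENNReal.ofReal (1 - S.α) ∂(S.sampleLaw N).prod S.QX := by simp
    _ ≤ _ := lintegral_mono_ae hae
    _ = ∫⁻ p, S.coverageGivenXTrain n p.1 p.2 ∂(S.sampleLaw N).prod S.QX +
        (∫⁻ p, C * (ENNReal.ofReal t + S.calBound N n k (min δ 1) t p.1)
          ∂(S.sampleLaw N).prod S.QX +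
        ∫⁻ p, (C * s + s ^ (-ℓ) * ENNReal.ofReal (S.H N p.1 p.2) ^ ℓ)
          ∂(S.sampleLaw N).prod S.QX) := by
        rw [← lintegral_add_left hm1, ← lintegral_add_right]
        exact hm1.add ((hm2.const_mul _).const_add _)
    _ ≤ _ := by
        gcongr
        exact S.lintegral_coverageGivenXTrain_le N n

/-- Markov's inequality is applied to `calBound` and to `H^ℓ`, each with failure probability `β /
2`. Taking an `ℓ`-th root gives a pointwise bound on `H`. -/
lemma Assumptions.le_measure_coverageGivenXTrain (h : S.Assumptions r b₁ b₂ δ M k ℓ) (hr : 0 < r)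
    (hb₁ : 0 < b₁) (hb₂ : 0 < b₂) (hδ : 0 < δ) (hM : 0 < M) (hk : 0 < k) (hℓ : 0 < ℓ) {C K : ℝ≥0∞}
    (hC : C = ENNReal.ofReal (covConst r b₁ b₂ k)) (hK : K = ENNReal.ofReal (2 + M ^ (1 + δ)))
    {β : ℝ} (hβ : 0 < β) {ε : ℝ≥0∞} (hε : ε = ENNReal.ofReal (β / 2))
    {N n : ℕ} (hn : 2 ≤ n) (hA : S.wHatErr N k ≠ ∞) :
    ENNReal.ofReal (1 - β) ≤ ((S.sampleLaw N).prod S.QX)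
      {p | ENNReal.ofReal (1 - S.α) ≤ S.coverageGivenXTrain n p.1 p.2 +
        (C * (1 + ε⁻¹ * K) * (2 * calRate δ n + S.wHatErr N k ^ (1 / (2 + k))) +
          C * ε⁻¹ ^ (1 / ℓ) * S.wErr N ℓ ^ (1 / ℓ))} := by
  obtain ⟨t, ht, htR, hint⟩ := h.exists_threshold hδ hM hk hn hA
  rw [← hK] at hint
  have hreg := h.regularAt hr.le
  have hε0 : ε ≠ 0 := by rw [hε]; simpa using hβ
  have hεt : ε ≠ ∞ := by rw [hε]; exact ENNReal.ofReal_ne_top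
  have hm1 : Measurable fun p : Sample 𝒳 N × 𝒳 => S.calBound N n k (min δ 1) t p.1 :=
    (S.measurable_calBound N n k (min δ 1) t).comp measurable_fst
  have hm2 : Measurable fun p : Sample 𝒳 N × 𝒳 => ENNReal.ofReal (S.H N p.1 p.2) ^ ℓ :=
    (S.measurable_H N).ennreal_ofReal.pow_const ℓ
  have hB1 := measure_inv_mul_lintegral_lt_le ((S.sampleLaw N).prod S.QX) hm1 hε0 hεt
  have hB2 := measure_inv_mul_lintegral_lt_le ((S.sampleLaw N).prod S.QX) hm2 hε0 hεt
  rw [lintegral_prod _ hm1.aemeasurable] at hB1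
  simp only [lintegral_const, measure_univ, mul_one] at hB1
  rw [S.lintegral_H_rpow h.absCont] at hB2
  have hae : ∀ᵐ p ∂(S.sampleLaw N).prod S.QX,
      p ∈ {p : Sample 𝒳 N × 𝒳 | ∫⁻ x, S.wHat N p.1 x ∂S.PX = 1 ∧ S.RegularAt r b₁ b₂ p.2} := by
    filter_upwards [Measure.quasiMeasurePreserving_fst.ae (h.ae_lintegral_wHat N),
      Measure.quasiMeasurePreserving_snd.ae (h.absCont.ae_le hreg)] with p hp1 hp2
    exact ⟨hp1, hp2⟩
  refine prob_le_of_compl_subset hβ.le hae ((measure_union_le _ _).trans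
    ((add_le_add hB1 hB2).trans ?_)) ?_
  · rw [hε, ← ENNReal.ofReal_add (by positivity) (by positivity), add_halves]
  rintro p ⟨hp1, hp2⟩ hpB
  have hU : S.calBound N n k (min δ 1) t p.1 ≤
      ε⁻¹ * ∫⁻ tr, S.calBound N n k (min δ 1) t tr ∂S.sampleLaw N :=
    not_lt.1 fun hlt => hpB (Or.inl hlt)
  have hH : ENNReal.ofReal (S.H N p.1 p.2) ^ ℓ ≤ ε⁻¹ * S.wErr N ℓ :=
    not_lt.1 fun hlt => hpB (Or.inr hlt)
  refine (S.ofReal_le_coverageGivenXTrain_add hr hb₁ hb₂ hk.le (lt_min hδ one_pos).le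
    (min_le_right δ 1) ht hreg h.levels (by omega : 0 < n) hp1 hp2).trans ?_
  rw [← hC, mul_assoc C (1 + _), mul_assoc C (ε⁻¹ ^ _)]
  gcongr
  · calc _ ≤ ENNReal.ofReal t + ε⁻¹ * (K * ENNReal.ofReal t) := by
          gcongr
          exact hU.trans (by gcongr)
      _ = (1 + ε⁻¹ * K) * ENNReal.ofReal t := by ring
      _ ≤ _ := by gcongr
  · refine (min_le_right _ _).trans ?_
    gcongr
    rw [← ENNReal.mul_rpow_of_nonneg _ _ (by positivity), one_div, ENNReal.le_rpow_inv_iff hℓ]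
    exact hH

/-- Since `calBound` does not depend on `x`, it is simply averaged; all of `β` is spent on Markov's
inequality for the average of `H^ℓ` over the training fold at fixed `x`. -/
lemma Assumptions.le_measure_coverageGivenX (h : S.Assumptions r b₁ b₂ δ M k ℓ) (hr : 0 < r)
    (hb₁ : 0 < b₁) (hb₂ : 0 < b₂) (hδ : 0 < δ) (hM : 0 < M) (hk : 0 < k) (hℓ : 0 < ℓ) {C K : ℝ≥0∞}
    (hC : C = ENNReal.ofReal (covConst r b₁ b₂ k)) (hK : K = ENNReal.ofReal (2 + M ^ (1 + δ)))
    {β : ℝ} (hβ : 0 < β) {ε : ℝ≥0∞} (hε : ε = ENNReal.ofReal β)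
    {N n : ℕ} (hn : 2 ≤ n) (hA : S.wHatErr N k ≠ ∞) :
    ENNReal.ofReal (1 - β) ≤ S.QX
      {x | ENNReal.ofReal (1 - S.α) ≤ S.coverageGivenX N n x +
        (C * (1 + K) * (2 * calRate δ n + S.wHatErr N k ^ (1 / (2 + k))) +
          (C ^ ℓ * ε⁻¹ + 2 * C * ε⁻¹ ^ (1 / ℓ)) * S.wErr N ℓ ^ (1 / max 1 ℓ))} := by
  obtain ⟨t, ht, htR, hint⟩ := h.exists_threshold hδ hM hk hn hA
  rw [← hK] at hint
  have hreg := h.regularAt hr.le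
  have hε0 : ε ≠ 0 := by rw [hε]; simpa using hβ
  have hεt : ε ≠ ∞ := by rw [hε]; exact ENNReal.ofReal_ne_top
  have hmH : Measurable fun p : Sample 𝒳 N × 𝒳 => ENNReal.ofReal (S.H N p.1 p.2) :=
    (S.measurable_H N).ennreal_ofReal
  have hm2 : Measurable fun p : Sample 𝒳 N × 𝒳 => ENNReal.ofReal (S.H N p.1 p.2) ^ ℓ :=
    hmH.pow_const ℓ
  have hB := measure_inv_mul_lintegral_lt_le S.QX
    (hm2.lintegral_prod_left' (μ := S.sampleLaw N)) hε0 hεt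
  rw [← lintegral_prod_symm _ hm2.aemeasurable, S.lintegral_H_rpow h.absCont] at hB
  refine prob_le_of_compl_subset hβ.le (h.absCont.ae_le hreg) (hB.trans hε.le) ?_
  intro x hx hxB
  replace hxB : ∫⁻ tr, ENNReal.ofReal (S.H N tr x) ^ ℓ ∂S.sampleLaw N ≤ ε⁻¹ * S.wErr N ℓ :=
    not_lt.1 fun hlt => hxB hlt
  have hcal := S.measurable_calBound N n k (min δ 1) t
  have hHx : Measurable fun tr : Sample 𝒳 N => ENNReal.ofReal (S.H N tr x) :=
    hmH.comp measurable_prodMk_right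
  have hm1 : Measurable fun tr : Sample 𝒳 N =>
      C * (ENNReal.ofReal t + S.calBound N n k (min δ 1) t tr) := (hcal.const_add _).const_mul _
  have hm3 : Measurable fun tr : Sample 𝒳 N => min 1 (C * ENNReal.ofReal (S.H N tr x)) :=
    measurable_const.min (hHx.const_mul _)
  have hae : ∀ᵐ tr ∂S.sampleLaw N, ENNReal.ofReal (1 - S.α) ≤
      S.coverageGivenXTrain n tr x + (C * (ENNReal.ofReal t + S.calBound N n k (min δ 1) t tr) +
        min 1 (C * ENNReal.ofReal (S.H N tr x))) := by
    filter_upwards [h.ae_lintegral_wHat N] with tr htr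
    rw [hC]
    exact S.ofReal_le_coverageGivenXTrain_add hr hb₁ hb₂ hk.le (lt_min hδ one_pos).le
      (min_le_right δ 1) ht hreg h.levels (by omega : 0 < n) htr hx
  have hi1 : ∫⁻ tr, C * (ENNReal.ofReal t + S.calBound N n k (min δ 1) t tr) ∂S.sampleLaw N ≤
      C * (1 + K) * (2 * calRate δ n + S.wHatErr N k ^ (1 / (2 + k))) := by
    rw [lintegral_const_mul _ (hcal.const_add _), lintegral_add_right _ hcal, lintegral_const,
      measure_univ, mul_one, mul_assoc]
    gcongr
    calc _ ≤ ENNReal.ofReal t + K * ENNReal.ofReal t := by gcongr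
      _ = (1 + K) * ENNReal.ofReal t := by ring
      _ ≤ _ := by gcongr
  have hi2 : ∫⁻ tr, min 1 (C * ENNReal.ofReal (S.H N tr x)) ∂S.sampleLaw N ≤
      (C ^ ℓ * ε⁻¹ + 2 * C * ε⁻¹ ^ (1 / ℓ)) * S.wErr N ℓ ^ (1 / max 1 ℓ) := by
    -- For `ℓ ≤ 1` the cap gives `min 1 (C H) ≤ (C H)^ℓ`. For `ℓ ≥ 1`, splitting `H` at a level `s`
    -- replaces Jensen's inequality at the cost of a factor `2`.
    rcases le_total ℓ 1 with hℓ1 | hℓ1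
    · rw [max_eq_left hℓ1, div_one, ENNReal.rpow_one, add_mul]
      refine le_add_right ?_
      calc ∫⁻ tr, min 1 (C * ENNReal.ofReal (S.H N tr x)) ∂S.sampleLaw N
          ≤ ∫⁻ tr, C ^ ℓ * ENNReal.ofReal (S.H N tr x) ^ ℓ ∂S.sampleLaw N := by
            refine lintegral_mono fun tr => ?_
            rw [← ENNReal.mul_rpow_of_nonneg _ _ hℓ.le]
            exact min_one_le_rpow hℓ.le hℓ1
        _ = C ^ ℓ * ∫⁻ tr, ENNReal.ofReal (S.H N tr x) ^ ℓ ∂S.sampleLaw N :=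
            lintegral_const_mul _ (hHx.pow_const ℓ)
        _ ≤ C ^ ℓ * ε⁻¹ * S.wErr N ℓ := by
            rw [mul_assoc]
            gcongr
    · rw [max_eq_right hℓ1, add_mul]
      refine le_add_left ?_
      rw [mul_assoc, ← ENNReal.mul_rpow_of_nonneg _ _ (by positivity)]
      set s := (ε⁻¹ * S.wErr N ℓ) ^ (1 / ℓ) with hs
      have hsℓ : ε⁻¹ * S.wErr N ℓ = s ^ ℓ := by
        rw [hs, ← ENNReal.rpow_mul, one_div, inv_mul_cancel₀ hℓ.ne', ENNReal.rpow_one]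
      calc ∫⁻ tr, min 1 (C * ENNReal.ofReal (S.H N tr x)) ∂S.sampleLaw N
          ≤ ∫⁻ tr, C * (s + s ^ (1 - ℓ) * ENNReal.ofReal (S.H N tr x) ^ ℓ) ∂S.sampleLaw N := by
            refine lintegral_mono fun tr => (min_le_right _ _).trans ?_
            gcongr
            exact le_add_rpow_mul_rpow hℓ1 ENNReal.ofReal_ne_top
        _ = C * (s + s ^ (1 - ℓ) * ∫⁻ tr, ENNReal.ofReal (S.H N tr x) ^ ℓ ∂S.sampleLaw N) := by
            rw [lintegral_const_mul _ (((hHx.pow_const ℓ).const_mul _).const_add _),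
              lintegral_add_left measurable_const, lintegral_const, measure_univ, mul_one,
              lintegral_const_mul _ (hHx.pow_const ℓ)]
        _ ≤ C * (s + s) := by
            gcongr
            refine le_trans ?_ (rpow_mul_rpow_le hℓ (by ring : 1 - ℓ + ℓ = 1))
            gcongr
            exact hxB.trans hsℓ.le
        _ = 2 * C * s := by ring
  calc ENNReal.ofReal (1 - S.α)
      = ∫⁻ _, ENNReal.ofReal (1 - S.α) ∂S.sampleLaw N := by simp
    _ ≤ _ := lintegral_mono_ae hae
    _ = ∫⁻ tr, S.coverageGivenXTrain n tr x ∂S.sampleLaw N +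
        (∫⁻ tr, C * (ENNReal.ofReal t + S.calBound N n k (min δ 1) t tr) ∂S.sampleLaw N +
        ∫⁻ tr, min 1 (C * ENNReal.ofReal (S.H N tr x)) ∂S.sampleLaw N) := by
        rw [← lintegral_add_left hm1, ← lintegral_add_right]
        exact hm1.add hm3
    _ ≤ _ := by
        gcongr
        exact S.lintegral_coverageGivenXTrain_le_coverageGivenX N n x

end CQRProblem

theorem mainTheorem4 (r b₁ b₂ δ M k ℓ : ℝ) (hr : 0 < r) (hb₁ : 0 < b₁) (hb₂ : 0 < b₂)
    (hδ : 0 < δ) (hM : 0 < M) (hk : 0 < k) (hℓ : 0 < ℓ) :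
    (∃ B₁ : ℝ≥0, ∀ (𝒳 : Type u) [MeasurableSpace 𝒳] (S : CQRProblem 𝒳),
      S.Assumptions r b₁ b₂ δ M k ℓ → ∀ N n : ℕ, 2 ≤ n →
        ENNReal.ofReal (1 - S.α) -
            B₁ * (calRate δ n + S.wHatErr N k ^ (1 / (2 + k)) + S.wErr N ℓ ^ (1 / (1 + ℓ)))
          ≤ S.coverage N n) ∧
    (∀ β ∈ Set.Ioo (0 : ℝ) 1, ∃ B₂ : ℝ≥0,
      ∀ (𝒳 : Type u) [MeasurableSpace 𝒳] (S : CQRProblem 𝒳),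
        S.Assumptions r b₁ b₂ δ M k ℓ → ∀ N n : ℕ, 2 ≤ n →
          ENNReal.ofReal (1 - β) ≤ ((S.sampleLaw N).prod S.QX)
            {p | ENNReal.ofReal (1 - S.α) -
                B₂ * (calRate δ n + S.wHatErr N k ^ (1 / (2 + k)) + S.wErr N ℓ ^ (1 / ℓ))
              ≤ S.coverageGivenXTrain n p.1 p.2} ∧
          ENNReal.ofReal (1 - β) ≤ S.QX
            {x | ENNReal.ofReal (1 - S.α) -
                B₂ * (calRate δ n + S.wHatErr N k ^ (1 / (2 + k)) +
                  S.wErr N ℓ ^ (1 / max 1 ℓ))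
              ≤ S.coverageGivenX N n x}) := by
  obtain ⟨C, hC⟩ : ∃ C : ℝ≥0∞, C = ENNReal.ofReal (CQRProblem.covConst r b₁ b₂ k) := ⟨_, rfl⟩
  obtain ⟨K, hK⟩ : ∃ K : ℝ≥0∞, K = ENNReal.ofReal (2 + M ^ (1 + δ)) := ⟨_, rfl⟩
  have hCt : C ≠ ∞ := hC ▸ ENNReal.ofReal_ne_top
  have hKt : K ≠ ∞ := hK ▸ ENNReal.ofReal_ne_top
  constructor
  · refine ⟨(2 * (C * (1 + K)) + (C + 1) + 1).toNNReal, fun 𝒳 _ S h N n hn => ?_⟩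
    rw [ENNReal.coe_toNNReal (by finiteness)]
    exact tsub_mul_le_of_le_add
      (fun ha => h.ofReal_le_coverage_add hr hb₁ hb₂ hδ hM hk hℓ hC hK hn
        fun hA => ha (by rw [hA, ENNReal.top_rpow_of_pos (by positivity)])) le_rfl
  rintro β ⟨hβ0, -⟩
  obtain ⟨ε, hε⟩ : ∃ ε : ℝ≥0∞, ε = ENNReal.ofReal (β / 2) := ⟨_, rfl⟩
  obtain ⟨ε', hε'⟩ : ∃ ε : ℝ≥0∞, ε = ENNReal.ofReal β := ⟨_, rfl⟩
  have hε0 : ε⁻¹ ≠ ∞ := ENNReal.inv_ne_top.2 (by rw [hε]; simpa using hβ0)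
  have hε'0 : ε'⁻¹ ≠ ∞ := ENNReal.inv_ne_top.2 (by rw [hε']; simpa using hβ0)
  have hp1 : ε⁻¹ ^ (1 / ℓ) ≠ ∞ := ENNReal.rpow_ne_top_of_nonneg (by positivity) hε0
  have hp2 : ε'⁻¹ ^ (1 / ℓ) ≠ ∞ := ENNReal.rpow_ne_top_of_nonneg (by positivity) hε'0
  have hp3 : C ^ ℓ ≠ ∞ := ENNReal.rpow_ne_top_of_nonneg hℓ.le hCt
  -- The sum of the constants required by the two conditional bounds, so that a single `B₂` serves
  -- both.
  set B := (2 * (C * (1 + ε⁻¹ * K)) + C * ε⁻¹ ^ (1 / ℓ) + 1) +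
    (2 * (C * (1 + K)) + (C ^ ℓ * ε'⁻¹ + 2 * C * ε'⁻¹ ^ (1 / ℓ)) + 1) with hB
  have hBt : B ≠ ∞ := by
    have h1 : C * (1 + ε⁻¹ * K) ≠ ∞ :=
      ENNReal.mul_ne_top hCt (ENNReal.add_ne_top.2 ⟨by simp, ENNReal.mul_ne_top hε0 hKt⟩)
    have h2 := ENNReal.mul_ne_top hCt hp1
    have h3 := ENNReal.mul_ne_top hp3 hε'0
    have h4 : 2 * C * ε'⁻¹ ^ (1 / ℓ) ≠ ∞ :=
      ENNReal.mul_ne_top (ENNReal.mul_ne_top (by simp) hCt) hp2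
    rw [hB]
    simp only [ne_eq, ENNReal.add_eq_top, not_or]
    exact ⟨⟨⟨ENNReal.mul_ne_top (by simp) h1, h2⟩, by simp⟩,
      ⟨by finiteness, h3, h4⟩, by simp⟩
  refine ⟨B.toNNReal, fun 𝒳 _ S h N n hn => ?_⟩
  rw [ENNReal.coe_toNNReal hBt]
  -- An infinite error makes the claimed lower bound on coverage zero, since `B ≠ 0`.
  by_cases hA : S.wHatErr N k = ∞
  · have hrate : S.wHatErr N k ^ (1 / (2 + k)) = ∞ := by
      rw [hA, ENNReal.top_rpow_of_pos (by positivity)]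
    have hB0 : B ≠ 0 := by simp [hB]
    have hsub : ∀ u v c p : ℝ≥0∞, c - B * (u + ∞ + v) ≤ p := fun u v c p => by
      simp [ENNReal.mul_top hB0]
    have hβ1 : ENNReal.ofReal (1 - β) ≤ 1 := by simpa using hβ0.le
    simpa only [hrate, hsub, Set.ofPred_true, measure_univ, and_self] using hβ1
  exact ⟨(h.le_measure_coverageGivenXTrain hr hb₁ hb₂ hδ hM hk hℓ hC hK hβ0 hε hn hA).trans
      (measure_mono fun p hp => tsub_mul_le_of_le_add (fun _ => hp) le_self_add),
    (h.le_measure_coverageGivenX hr hb₁ hb₂ hδ hM hk hℓ hC hK hβ0 hε' hn hA).trans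
      (measure_mono fun x hx => tsub_mul_le_of_le_add (fun _ => hx) le_add_self)⟩
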